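/- Theorem 3.2. Let $A,D\in\mathbb C^{n\times n}$, $\lambda_0\in\mathbb C$, and let $k\ge1$ and $s_1,\dots,s_{k-1}\ge 0$, $s_k>0$ be integers. Let $[\Xi\ \ \Xi_c]\in\mathbb C^{n\times n}$ be invertible with $$A[\Xi\ \ \Xi_c]=[\Xi\ \ \Xi_c]\begin{bmatrix}\lambda_0I+N&0\\0&A_{22}\end{bmatrix},\qquad N=\operatorname{diag}(N_1,\dots,N_k),\qquad \lambda_0\notin\Lambda(A_{22}),$$ where $N_j$ is the $j\times j$ block matrix with blocks of size $s_j\times s_j$, identity blocks $I_{s_j}$ on the first block superdiagonal and zero blocks elsewhere. Put $[\Sigma\ \ \Sigma_c]=[\Xi\ \ \Xi_c]^{-*}$ and partition $\Xi=[\Xi_1\ \dots\ \Xi_k]$, $\Xi_j=[\Xi_{j1}\ \dots\ \Xi_{jj}]$, $\Sigma=[\Sigma_1\ \dots\ \Sigma_k]$, $\Sigma_j=[\Sigma_{j1}\ \dots\ \Sigma_{jj}]$, where $\Xi_{jm}$ and $\Sigma_{jm}$ have $s_j$ columns. For $1\le j\le k$ let $$\tilde\Xi_j=[\Xi_{j1}\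 \Xi_{j+1,1}\ \dots\ \Xi_{k1}],\qquad \tilde\Sigma_j=[\Sigma_{jj}\ \Sigma_{j+1,j+1}\ \dots\ \Sigma_{kk}],\qquad W_j=\tilde\Sigma_j^*D\tilde\Xi_j .$$ Fix $\rho\in\{1,\dots,k\}$ and assume that $W_\rho$ and, if $\rho<k$, also $W_{\rho+1}$ are invertible (in particular, this holds under the generic condition that all of $W_1,\dots,W_k$ are invertible). Let $$G_\rho^{(\rho)}=-W_{\rho+1}^{-1}\tilde\Sigma_{\rho+1}^*D\,\Xi_{\rho1},\qquad S_\rho=\Sigma_{\rho\rho}^*D\,\Xi_{\rho1}+\Sigma_{\rho\rho}^*D\,\tilde\Xi_{\rho+1}G_\rho^{(\rho)}$$ (for $\rho=k$ the matrix $G_\rho^{(\rho)}$ is void and $S_k=W_k$), and let $\Theta_\rho$ be the $\rho\times\rho$ block matrix with blocks of size $s_\rho\times s_\rho$, identity blocks $I_{s_\rho}$ on the first block superdiagonal, $S_\rho$ in the bottom left corner and zero blocks elsewhere ($\Theta_1=S_1$). Let $\Omega\in\mathbb C^{r\times r}$ and $\tilde\Phi\in\mathbb C^{\rho s_\rho\times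 r}$ satisfy $\operatorname{rank}\tilde\Phi=r$ and $\Theta_\rho\tilde\Phi=\tilde\Phi\Omega$, suppose that the eigenvalues of $\Omega$ are different from the remaining eigenvalues of $\Theta_\rho$ (counted with algebraic multiplicity), and let $Q_1\in\mathbb C^{s_\rho\times r}$ be the top block of $\tilde\Phi$. Then for all sufficiently small $t>0$ there are $C=C(t)\in\mathbb C^{r\times r}$ and $H=H(t)\in\mathbb C^{n\times r}$ of full column rank $r$ with $(A+tD)H=HC$ such that, as $t\to0^+$, $$C=\lambda_0I+t^{1/\rho}\Omega+O(t^{2/\rho}),\qquad H=\tilde\Xi_\rho\begin{bmatrix}I_{s_\rho}\\G_\rho^{(\rho)}\end{bmatrix}Q_1+\sum_{i=1}^k\Xi_iH_i+O(t),$$ where $H_i=H_i(t)$ has $i$ block rows, each with $s_i$ rows, and $$H_\rho=\begin{bmatrix}0\\Q_1(t^{1/\rho}\Omega)\\\vdots\\Q_1(t^{1/\rho}\Omega)^{\rho-1}\end{bmatrix}+O\left(\begin{bmatrix}t^{1/\rho}\\t^{2/\rho}\\\vdots\\t\end{bmatrix}\right),$$ $$H_i=O\left(\begin{bmatrix}t^{1-i/\rho}&t^{1-(i-1)/\rho}&\cdots&t^{1-1/\rho}\end{bmatrix}^T\right)\quad(1\le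 i\le\rho-1),$$ and, for $\rho+1\le i\le k$, the first block row of $H_i$ is $O(t^{1/\rho})$ and its $m$-th block row is $O(t^{\min(m-1,\rho)/\rho})$ for $2\le m\le i$, that is, $$H_i=O\left(\begin{bmatrix}t^{1/\rho}&t^{1/\rho}&t^{2/\rho}&\cdots&t^{1-1/\rho}&t&\cdots&t\end{bmatrix}^T\right).$$ -/

import Mathlib

open Filter Topology

namespace JordanPert

/-- The admissible Jordan block sizes `1, …, k`. -/
abbrev BlockSize (k : ℕ) : Type := {i : ℕ // i ∈ Finset.Icc 1 k}

/-- Column index of `Ξ = [Ξ₁ … Ξ_k]`, `Ξ_i = [Ξ_{i1} … Ξ_{ii}]`, where `Ξ_{im}` has `s i` columns.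
The index `⟨i, (m, p)⟩` is column `p` of `Ξ_{i,m+1}` (positions are counted from `0`). -/
abbrev JordanIdx (k : ℕ) (s : ℕ → ℕ) : Type := Σ i : BlockSize k, Fin i.1 × Fin (s i.1)

/-- Index set with one copy of `Fin (s i)` for each block size `i` with `j ≤ i ≤ k`;
it is empty for `j = k + 1`. -/
abbrev TailIdx (k : ℕ) (s : ℕ → ℕ) (j : ℕ) : Type :=
  Σ i : {i : BlockSize k // j ≤ i.1}, Fin (s i.1.1)

theorem BlockSize.pos {k : ℕ} (i : BlockSize k) : 0 < i.1 := (Finset.mem_Icc.mp i.2).1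

/-- First position in a chain of length `i`. -/
def firstPos {k : ℕ} (i : BlockSize k) : Fin i.1 := ⟨0, i.pos⟩

/-- Last position in a chain of length `i`. -/
def lastPos {k : ℕ} (i : BlockSize k) : Fin i.1 := ⟨i.1 - 1, Nat.sub_lt i.pos Nat.one_pos⟩

/-- `N = diag(N₁, …, N_k)`, where `N_i` is the `i × i` block matrix with identity blocks `I_{s_i}`
on the first block superdiagonal. -/
def nilp (k : ℕ) (s : ℕ → ℕ) : Matrix (JordanIdx k s) (JordanIdx k s) ℂ :=
  Matrix.blockDiagonal' fun i : BlockSize k =>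
    (Matrix.of fun p q => if (p.1 : ℕ) + 1 = (q.1 : ℕ) ∧ p.2 = q.2 then 1 else 0 :
      Matrix (Fin i.1 × Fin (s i.1)) (Fin i.1 × Fin (s i.1)) ℂ)

variable {n k : ℕ} {s : ℕ → ℕ}

/-- The block column `Ξ_i` of `Ξ`. -/
def blockCol (X : Matrix (Fin n) (JordanIdx k s) ℂ) (i : BlockSize k) :
    Matrix (Fin n) (Fin i.1 × Fin (s i.1)) ℂ :=
  Matrix.of fun a q => X a ⟨i, q⟩

/-- The sub-block column `Ξ_{i,m+1}` of `Ξ`. -/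
def subCol (X : Matrix (Fin n) (JordanIdx k s) ℂ) (i : BlockSize k) (m : Fin i.1) :
    Matrix (Fin n) (Fin (s i.1)) ℂ :=
  Matrix.of fun a p => X a ⟨i, (m, p)⟩

/-- `[Ξ_{j1} Ξ_{j+1,1} … Ξ_{k1}]`. -/
def firstCols (X : Matrix (Fin n) (JordanIdx k s) ℂ) (j : ℕ) :
    Matrix (Fin n) (TailIdx k s j) ℂ :=
  Matrix.of fun a q => subCol X q.1.1 (firstPos q.1.1) a q.2

/-- `[Σ_{jj} Σ_{j+1,j+1} … Σ_{kk}]`. -/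
def lastCols (Y : Matrix (Fin n) (JordanIdx k s) ℂ) (j : ℕ) :
    Matrix (Fin n) (TailIdx k s j) ℂ :=
  Matrix.of fun a q => subCol Y q.1.1 (lastPos q.1.1) a q.2

/-- `W_j`, the product of the adjoint of `[Σ_{jj} … Σ_{kk}]`, `D` and `[Ξ_{j1} … Ξ_{k1}]`.
For `j = k + 1` it is the `0 × 0` matrix. -/
def matW (D : Matrix (Fin n) (Fin n) ℂ) (X Y : Matrix (Fin n) (JordanIdx k s) ℂ) (j : ℕ) :
    Matrix (TailIdx k s j) (TailIdx k s j) ℂ :=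
  (lastCols Y j).conjTranspose * D * firstCols X j

/-- `G_ρ = - W_{ρ+1}⁻¹ Z`, where `Z` stacks the blocks `Σ_{ii}* D Ξ_{ρ1}`, `ρ < i ≤ k`. -/
noncomputable def matG (D : Matrix (Fin n) (Fin n) ℂ) (X Y : Matrix (Fin n) (JordanIdx k s) ℂ)
    (ρ : BlockSize k) : Matrix (TailIdx k s (ρ.1 + 1)) (Fin (s ρ.1)) ℂ :=
  -((matW D X Y (ρ.1 + 1))⁻¹ *
    ((lastCols Y (ρ.1 + 1)).conjTranspose * D * subCol X ρ (firstPos ρ)))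

/-- The block matrix with `I_{s_ρ}` on top of `G`, its rows indexed by the sizes `ρ, …, k`. -/
def stackI (ρ : BlockSize k) (G : Matrix (TailIdx k s (ρ.1 + 1)) (Fin (s ρ.1)) ℂ) :
    Matrix (TailIdx k s ρ.1) (Fin (s ρ.1)) ℂ :=
  Matrix.of fun p q =>
    if h : ρ.1 + 1 ≤ p.1.1.1 then G ⟨⟨p.1.1, h⟩, p.2⟩ q
    else if (p.2 : ℕ) = (q : ℕ) then 1 else 0

/-- `S_ρ = Σ_{ρρ}* D Ξ_{ρ1} + (Σ_{ρρ}* D [Ξ_{ρ+1,1} … Ξ_{k1}]) G_ρ`. -/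
noncomputable def matS (D : Matrix (Fin n) (Fin n) ℂ) (X Y : Matrix (Fin n) (JordanIdx k s) ℂ)
    (ρ : BlockSize k) : Matrix (Fin (s ρ.1)) (Fin (s ρ.1)) ℂ :=
  (subCol Y ρ (lastPos ρ)).conjTranspose * D * subCol X ρ (firstPos ρ) +
    (subCol Y ρ (lastPos ρ)).conjTranspose * D * firstCols X (ρ.1 + 1) * matG D X Y ρ

/-- `Θ_ρ`: the `ρ × ρ` block matrix with `I_{s_ρ}` on the first block superdiagonal, `S_ρ` in the
bottom left corner and zeros elsewhere. For `ρ = 1` it is `S_1`. -/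
noncomputable def matTheta (D : Matrix (Fin n) (Fin n) ℂ)
    (X Y : Matrix (Fin n) (JordanIdx k s) ℂ) (ρ : BlockSize k) :
    Matrix (Fin ρ.1 × Fin (s ρ.1)) (Fin ρ.1 × Fin (s ρ.1)) ℂ :=
  Matrix.of fun p q =>
    if (p.1 : ℕ) + 1 = (q.1 : ℕ) then (if p.2 = q.2 then 1 else 0)
    else if p.1 = lastPos ρ ∧ q.1 = firstPos ρ then matS D X Y ρ p.2 q.2 else 0

/-- The top block `Q₁` of a matrix with `ρ` block rows. -/
def topBlock {r : ℕ} (ρ : BlockSize k) (Φ : Matrix (Fin ρ.1 × Fin (s ρ.1)) (Fin r) ℂ) :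
    Matrix (Fin (s ρ.1)) (Fin r) ℂ :=
  Matrix.of fun p q => Φ (firstPos ρ, p) q

/-- `M(t) = O(t^c)` entrywise, as `t → 0⁺`. -/
def MatBigO {α β : Type*} (M : ℝ → Matrix α β ℂ) (c : ℝ) : Prop :=
  ∀ a b, (fun t => M t a b) =O[𝓝[>] (0 : ℝ)] fun t : ℝ => t ^ c

/-- Block row `m + 1` of a matrix with `i` block rows. -/
def blockRow {r : ℕ} {i : BlockSize k} (M : Matrix (Fin i.1 × Fin (s i.1)) (Fin r) ℂ)
    (m : Fin i.1) : Matrix (Fin (s i.1)) (Fin r) ℂ :=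
  Matrix.of fun p q => M (m, p) q

end JordanPert

open JordanPert

/-! In the basis `[Ξ Ξ_c]` the matrix `A + tD - λ₀` becomes `K + tB` with `K = diag(N, A₂₂ - λ₀)`.
Put `z = t^(1/ρ)` and look for an invariant subspace spanned by `diag(z^w) y` on which the matrix
acts as `z C`. The integer weights `w` grow by one along each Jordan chain and are capped at `ρ`;
after division of row `a` by `z^min(w a + 1, ρ)` the equation is polynomial in `z`, so `z = 0` is an
ordinary point and not a branch point (`mul_diagonal_of_scaled`).

At `z = 0` the last rows of the chains longer than `ρ` force the first block rows to be `[I; G] Q₁`,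
and the rows of size `ρ` then satisfy `Θ_ρ Φ = Φ Ω` (`firstRows_eq_stackI`, `rowsOf_limit_mul`). All
other rows are determined by these, because `Ω` and `A₂₂ - λ₀` are invertible
(`exists_limit_solution`); `Ω` is invertible because `S_ρ`, a Schur complement in `W_ρ`, is.

Under the normalization `P y = 1` the linearization at the limit solution is injective: on the rows
of size `ρ` it is a Sylvester equation with separated spectra (`exists_leftInverse_of_separated`),
and the remaining rows follow. The implicit function theorem gives `y(z) = y₀ + O(z)` and `C(z) = Ω
+ O(z)`. Undoing the scaling, every order in the theorem is a weight divided by `ρ`, with one more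
`1/ρ` where the limit has been subtracted. -/

namespace JordanPert

/-! ### Sylvester equations and spectral separation -/

open Polynomial in
/-- The homogeneous Sylvester equation has only the trivial solution when the characteristic
polynomials are coprime. -/
theorem eq_zero_of_sylvester {α β : Type*} [Fintype α] [DecidableEq α] [Fintype β] [DecidableEq β]
    {M : Matrix α α ℂ} {N : Matrix β β ℂ} {X : Matrix α β ℂ}
    (hc : IsCoprime N.charpoly M.charpoly) (h : M * X = X * N) : X = 0 := by
  have key : ∀ p : ℂ[X], aeval M p * X = X * aeval N p := by
    intro p
    induction p using Polynomial.induction_on' with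
    | add p q hp hq => simp only [map_add, Matrix.add_mul, Matrix.mul_add, hp, hq]
    | monomial j a =>
      have hpow : ∀ j : ℕ, M ^ j * X = X * N ^ j := by
        intro j
        induction j with
        | zero => simp
        | succ j ih =>
          rw [pow_succ, Matrix.mul_assoc, h, ← Matrix.mul_assoc, ih, Matrix.mul_assoc, pow_succ]
      simp only [aeval_monomial, Algebra.algebraMap_eq_smul_one, Matrix.smul_mul,
        Matrix.mul_smul, hpow, smul_mul_assoc, one_mul]
  obtain ⟨a, b, hab⟩ := hc
  have h1 : aeval M (a * N.charpoly + b * M.charpoly) * X = X := by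
    rw [hab, map_one, Matrix.one_mul]
  rw [← h1, map_add, map_mul, map_mul, Matrix.aeval_self_charpoly, mul_zero, add_zero,
    Matrix.mul_assoc, key N.charpoly, Matrix.aeval_self_charpoly, Matrix.mul_zero, Matrix.mul_zero]

/-- A matrix with independent columns can be completed to an invertible one. -/
theorem exists_completion {α : Type*} [Fintype α] [DecidableEq α] {r : ℕ}
    (Φ : Matrix α (Fin r) ℂ) (hΦ : LinearIndependent ℂ Φ.col) :
    ∃ (d : ℕ) (b : Module.Basis (Fin r ⊕ Fin d) ℂ (α → ℂ)), ∀ q, b (Sum.inl q) = Φ.col q := by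
  classical
  let b := Module.Basis.sumExtend hΦ
  have : Fintype (Fin r ⊕ Module.Basis.sumExtendIndex hΦ) :=
    FiniteDimensional.fintypeBasisIndex b
  have : Fintype (Module.Basis.sumExtendIndex hΦ) := Fintype.ofInjective
    (Sum.inr : _ → Fin r ⊕ Module.Basis.sumExtendIndex hΦ) Sum.inr_injective
  refine ⟨_, b.reindex (Equiv.sumCongr (Equiv.refl _) (Fintype.equivFin _)), fun q => ?_⟩
  simp only [b, Module.Basis.sumExtend, Module.Basis.reindex_apply]
  simp
  rfl

/-- If `Φ` spans an invariant subspace of `Θ` on which `Θ` acts as `Ω`, with spectrum separated from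
the remaining one, then `Φ` has a left inverse `P` such that every solution `V` of
`Θ V - V Ω = Φ C` equals `Φ P V`. -/
theorem exists_leftInverse_of_separated {α : Type*} [Fintype α] [DecidableEq α] {r : ℕ}
    (Θ : Matrix α α ℂ) (Ω : Matrix (Fin r) (Fin r) ℂ) (Φ : Matrix α (Fin r) ℂ)
    (hrank : Φ.rank = r) (hΦ : Θ * Φ = Φ * Ω)
    (hsep : ∀ μ ∈ Ω.charpoly.roots, μ ∉ Θ.charpoly.roots - Ω.charpoly.roots) :
    ∃ P : Matrix (Fin r) α ℂ, P * Φ = 1 ∧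
      ∀ (V : Matrix α (Fin r) ℂ) (C : Matrix (Fin r) (Fin r) ℂ),
        Θ * V - V * Ω = Φ * C → V = Φ * (P * V) := by
  have hli : LinearIndependent ℂ Φ.col := by
    rw [linearIndependent_iff_card_eq_finrank_span, Set.finrank, ← Matrix.rank_eq_finrank_span_cols,
      hrank, Fintype.card_fin]
  obtain ⟨d, b, hb⟩ := exists_completion Φ hli
  set U : Matrix α (Fin r ⊕ Fin d) ℂ := (Pi.basisFun ℂ α).toMatrix b with hU
  set U' : Matrix (Fin r ⊕ Fin d) α ℂ := b.toMatrix (Pi.basisFun ℂ α) with hU'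
  have hUU' : U * U' = 1 := Module.Basis.toMatrix_mul_toMatrix_flip _ _
  have hU'U : U' * U = 1 := Module.Basis.toMatrix_mul_toMatrix_flip _ _
  have hU1 : U.toCols₁ = Φ := by
    ext a q
    simp [hU, Module.Basis.toMatrix_apply, hb]
  set T := U' * Θ * U with hT
  have hchar : T.charpoly = Θ.charpoly := by
    have h1 : T = LinearMap.toMatrix b b (Matrix.toLin' Θ) := by
      rw [← basis_toMatrix_mul_linearMap_toMatrix_mul_basis_toMatrix b (Pi.basisFun ℂ α)
        b (Pi.basisFun ℂ α) (Matrix.toLin' Θ), hT]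
      congr 2
      simp [LinearMap.toMatrix_eq_toMatrix']
    rw [h1, LinearMap.charpoly_toMatrix, ← LinearMap.charpoly_toMatrix _ (Pi.basisFun ℂ α)]
    simp [LinearMap.toMatrix_eq_toMatrix']
  have hdec : U = Matrix.fromCols Φ U.toCols₂ := by
    rw [← hU1, Matrix.fromCols_toCols]
  have hdec' : U' = Matrix.fromRows U'.toRows₁ U'.toRows₂ := (Matrix.fromRows_toRows _).symm
  set Φc := U.toCols₂
  set P := U'.toRows₁
  set Pc := U'.toRows₂
  have hI : Matrix.fromBlocks (P * Φ) (P * Φc) (Pc * Φ) (Pc * Φc) = 1 := by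
    rw [← Matrix.fromRows_mul_fromCols, ← hdec, ← hdec', hU'U]
  rw [← Matrix.fromBlocks_one, Matrix.fromBlocks_inj] at hI
  obtain ⟨hPΦ, -, hPcΦ, hPcΦc⟩ := hI
  have hsum : Φ * P + Φc * Pc = 1 := by
    rw [← Matrix.fromCols_mul_fromRows, ← hdec, ← hdec', hUU']
  have hTblock : T = Matrix.fromBlocks Ω (P * Θ * Φc) 0 (Pc * Θ * Φc) := by
    rw [hT, hdec, hdec', Matrix.fromRows_mul, Matrix.fromRows_mul_fromCols]
    rw [Matrix.mul_assoc P Θ Φ, Matrix.mul_assoc Pc Θ Φ, hΦ, ← Matrix.mul_assoc, hPΦ,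
      ← Matrix.mul_assoc, hPcΦ, Matrix.one_mul, Matrix.zero_mul]
  have hprod : Θ.charpoly = Ω.charpoly * (Pc * Θ * Φc).charpoly := by
    rw [← hchar, hTblock, Matrix.charpoly_fromBlocks_zero₂₁]
  have hne : ∀ {m : ℕ} (M : Matrix (Fin m) (Fin m) ℂ), M.charpoly ≠ 0 := fun M =>
    (Matrix.charpoly_monic M).ne_zero
  -- In a basis extending the columns of `Φ`, `Θ` is block triangular, so the multiset difference of
  -- roots in `hsep` is the root multiset of the complementary block. Over `ℂ`, disjoint roots mean
  -- coprime polynomials.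
  have hcop : IsCoprime Ω.charpoly (Pc * Θ * Φc).charpoly := by
    rw [Polynomial.isCoprime_iff_aeval_ne_zero_of_isAlgClosed ℂ ℂ]
    intro a
    by_contra! hcon
    have h1 : a ∈ Ω.charpoly.roots := by
      rw [Polynomial.mem_roots (hne _)]; simpa using hcon.1
    refine hsep a h1 ?_
    rw [hprod, Polynomial.roots_mul (mul_ne_zero (hne _) (hne _)), add_tsub_cancel_left,
      Polynomial.mem_roots (hne _)]
    simpa using hcon.2
  refine ⟨P, hPΦ, fun V C hV => ?_⟩
  -- `Pc` annihilates `Φ C` and intertwines `Θ` with its complementary block, so `Pc V` solves a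
  -- homogeneous Sylvester equation.
  have hPcV : Pc * V = 0 := by
    refine eq_zero_of_sylvester hcop ?_
    have h1 : Pc * (Θ * V - V * Ω) = 0 := by
      rw [hV, ← Matrix.mul_assoc, hPcΦ, Matrix.zero_mul]
    rw [Matrix.mul_sub, sub_eq_zero] at h1
    have h2 : Pc * Θ = Pc * Θ * Φc * Pc := by
      have h3 : Pc * Θ * (Φ * P + Φc * Pc) = Pc * Θ := by rw [hsum, Matrix.mul_one]
      rw [Matrix.mul_add, ← Matrix.mul_assoc, Matrix.mul_assoc Pc Θ Φ, hΦ, ← Matrix.mul_assoc Pc,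
        hPcΦ, Matrix.zero_mul, Matrix.zero_mul, zero_add, ← Matrix.mul_assoc] at h3
      exact h3.symm
    rw [← Matrix.mul_assoc, ← h2, Matrix.mul_assoc, h1, Matrix.mul_assoc]
  calc V = (Φ * P + Φc * Pc) * V := by rw [hsum, Matrix.one_mul]
    _ = Φ * (P * V) := by
      rw [Matrix.add_mul, Matrix.mul_assoc, Matrix.mul_assoc Φc, hPcV, Matrix.mul_zero, add_zero]

/-! ### The implicit function theorem -/

/-- Implicit function theorem with a scalar parameter, the partial derivative being given
through directional derivatives. -/
theorem exists_implicit_curve {E : Type*} [NormedAddCommGroup E] [NormedSpace ℂ E]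
    [FiniteDimensional ℂ E] (F : ℂ × E → E) (hF : ContDiff ℂ 1 F) (x₀ : E) (h0 : F (0, x₀) = 0)
    (L : E → E) (hL : ∀ v, HasDerivAt (fun c : ℂ => F (0, x₀ + c • v)) (L v) 0)
    (hinj : ∀ v, L v = 0 → v = 0) :
    ∃ x : ℂ → E, (∀ᶠ z in 𝓝 (0 : ℂ), F (z, x z) = 0) ∧
      (fun z => x z - x₀) =O[𝓝 (0 : ℂ)] fun z => z := by
  have : CompleteSpace E := FiniteDimensional.complete ℂ E
  have hd : HasStrictFDerivAt F (fderiv ℂ F (0, x₀)) (0, x₀) :=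
    hF.contDiffAt.hasStrictFDerivAt one_ne_zero
  set F' := fderiv ℂ F (0, x₀)
  have hpart : ∀ v, F' (0, v) = L v := by
    intro v
    have h1 : HasDerivAt (fun c : ℂ => ((0, x₀ + c • v) : ℂ × E)) (0, v) 0 := by
      have h2 : HasDerivAt (fun c : ℂ => x₀ + c • v) v 0 := by
        simpa using ((hasDerivAt_id (0 : ℂ)).smul_const v).const_add x₀
      exact (hasDerivAt_const _ _).prodMk h2
    have h3 : HasFDerivAt F F' ((fun c : ℂ => ((0, x₀ + c • v) : ℂ × E)) 0) := by
      simpa using hd.hasFDerivAt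
    exact (h3.comp_hasDerivAt (0 : ℂ) h1).unique (hL v)
  have hinv : (F' ∘L ContinuousLinearMap.inr ℂ ℂ E).IsInvertible := by
    have hi : Function.Injective (F' ∘L ContinuousLinearMap.inr ℂ ℂ E : E →ₗ[ℂ] E) := by
      rw [injective_iff_map_eq_zero]
      intro v hv
      exact hinj v (by rw [← hpart]; simpa using hv)
    exact ⟨(LinearEquiv.ofInjectiveEndo _ hi).toContinuousLinearEquiv, by ext v; rfl⟩
  refine ⟨hd.implicitFunctionOfProdDomain hinv, ?_, ?_⟩
  · simpa [h0] using hd.eventually_apply_implicitFunctionOfProdDomain hinv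
  · have h1 := (hd.hasStrictFDerivAt_implicitFunctionOfProdDomain hinv).hasFDerivAt.isBigO_sub
    have h2 : hd.implicitFunctionOfProdDomain hinv 0 = x₀ :=
      (hd.eventually_apply_eq_iff_implicitFunctionOfProdDomain hinv).self_of_nhds.mp rfl
    simpa [h2] using h1

/-! ### The scaled pencil and its continuation from `z = 0` -/

section ScaledPencil

variable {ι : Type*} [Fintype ι] [DecidableEq ι] {r : ℕ}

/-- Row and column scaled form of `K + z ^ ρ B` for the weights `w`, after division by
`z ^ min (w a + 1) ρ` in row `a`. -/
def scaledMat (K B : Matrix ι ι ℂ) (w : ι → ℕ) (ρ : ℕ) (z : ℂ) : Matrix ι ι ℂ :=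
  Matrix.of fun a b => K a b + z ^ (ρ - min (w a + 1) ρ + w b) * B a b

/-- Scaling of the right-hand side that goes with `scaledMat`. -/
def scaledDiag (w : ι → ℕ) (ρ : ℕ) (z : ℂ) : Matrix ι ι ℂ :=
  Matrix.diagonal fun a => z ^ (w a + 1 - min (w a + 1) ρ)

/-- Since `0 ^ 0 = 1`, exactly the entries of `B` with exponent zero survive: those from columns of
weight `0` into rows of weight at least `ρ - 1`. -/
theorem scaledMat_zero_apply {α : Type*} (K B : Matrix α α ℂ) (w : α → ℕ) (ρ : ℕ) (a b : α) :
    scaledMat K B w ρ 0 a b = K a b + if ρ ≤ w a + 1 ∧ w b = 0 then B a b else 0 := by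
  simp only [scaledMat, Matrix.of_apply, zero_pow_eq]
  have : ρ - min (w a + 1) ρ + w b = 0 ↔ ρ ≤ w a + 1 ∧ w b = 0 := by omega
  simp only [this, ite_mul, one_mul, zero_mul]

theorem scaledDiag_zero_mul_apply (w : ι → ℕ) (ρ : ℕ) (V : Matrix ι (Fin r) ℂ) (a : ι) (q : Fin r) :
    (scaledDiag w ρ 0 * V) a q = if w a < ρ then V a q else 0 := by
  simp only [scaledDiag, Matrix.diagonal_mul, zero_pow_eq]
  have : w a + 1 - min (w a + 1) ρ = 0 ↔ w a < ρ := by omega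
  simp [this]

/-- A solution of the scaled equation gives a solution of the original one. -/
theorem mul_diagonal_of_scaled {K B : Matrix ι ι ℂ} {w : ι → ℕ} {ρ : ℕ}
    (hK : ∀ a b, K a b ≠ 0 → w b = min (w a + 1) ρ) {z : ℂ} {y : Matrix ι (Fin r) ℂ}
    {C : Matrix (Fin r) (Fin r) ℂ}
    (h : scaledMat K B w ρ z * y = scaledDiag w ρ z * (y * C)) :
    (K + z ^ ρ • B) * (Matrix.diagonal (fun a => z ^ w a) * y) =
      Matrix.diagonal (fun a => z ^ w a) * y * (z • C) := by
  have hscale : (K + z ^ ρ • B) * Matrix.diagonal (fun a => z ^ w a) =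
      Matrix.diagonal (fun a => z ^ min (w a + 1) ρ) * scaledMat K B w ρ z := by
    ext a b
    simp only [Matrix.mul_diagonal, Matrix.diagonal_mul, scaledMat, Matrix.of_apply,
      Matrix.add_apply, Matrix.smul_apply, smul_eq_mul]
    have h1 : K a b * z ^ w b = z ^ min (w a + 1) ρ * K a b := by
      by_cases hk : K a b = 0
      · simp [hk]
      · rw [hK a b hk, mul_comm]
    -- The natural subtraction does not truncate, as `min (w a + 1) ρ ≤ ρ`; in `hdiag` below the
    -- bound `min (w a + 1) ρ ≤ w a + 1` plays the same role.
    have h2 : z ^ ρ * z ^ w b = z ^ min (w a + 1) ρ * z ^ (ρ - min (w a + 1) ρ + w b) := by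
      rw [← pow_add, ← pow_add]
      congr 1
      omega
    linear_combination h1 + B a b * h2
  have hdiag : Matrix.diagonal (fun a => z ^ min (w a + 1) ρ) * scaledDiag w ρ z =
      z • Matrix.diagonal (fun a => z ^ w a) := by
    rw [scaledDiag, Matrix.diagonal_mul_diagonal, ← Matrix.diagonal_smul]
    congr 1
    ext a
    simp only [Pi.smul_apply, smul_eq_mul]
    rw [← pow_add, ← pow_succ']
    congr 1
    omega
  rw [← Matrix.mul_assoc, hscale, Matrix.mul_assoc, h, ← Matrix.mul_assoc, hdiag,
    Matrix.smul_mul, Matrix.mul_smul, Matrix.mul_assoc]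

open scoped Matrix.Norms.Elementwise in
/-- Continuation of a simple solution of the limiting equation to small parameters. -/
theorem exists_scaled_solution (K B : Matrix ι ι ℂ) (w : ι → ℕ) (ρ : ℕ)
    (P : Matrix (Fin r) ι ℂ) (y₀ : Matrix ι (Fin r) ℂ) (Ω : Matrix (Fin r) (Fin r) ℂ)
    (hP : P * y₀ = 1) (h0 : scaledMat K B w ρ 0 * y₀ = scaledDiag w ρ 0 * (y₀ * Ω))
    (hinj : ∀ (V : Matrix ι (Fin r) ℂ) (C : Matrix (Fin r) (Fin r) ℂ),
      scaledMat K B w ρ 0 * V = scaledDiag w ρ 0 * (V * Ω + y₀ * C) →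
      P * V = 0 → V = 0 ∧ C = 0) :
    ∃ (y : ℂ → Matrix ι (Fin r) ℂ) (C : ℂ → Matrix (Fin r) (Fin r) ℂ),
      (∀ᶠ z in 𝓝 (0 : ℂ), scaledMat K B w ρ z * y z = scaledDiag w ρ z * (y z * C z) ∧
        P * y z = 1) ∧
      (∀ a q, (fun z => y z a q - y₀ a q) =O[𝓝 (0 : ℂ)] fun z => z) ∧
      ∀ a q, (fun z => C z a q - Ω a q) =O[𝓝 (0 : ℂ)] fun z => z := by
  -- The second component removes the freedom `(y, C) ↦ (y T, T⁻¹ C T)` and makes the number of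
  -- equations equal to the number of unknowns.
  let F : ℂ × (Matrix ι (Fin r) ℂ × Matrix (Fin r) (Fin r) ℂ) →
      Matrix ι (Fin r) ℂ × Matrix (Fin r) (Fin r) ℂ := fun x =>
    (scaledMat K B w ρ x.1 * x.2.1 - scaledDiag w ρ x.1 * (x.2.1 * x.2.2), P * x.2.1 - 1)
  have hV : ∀ a q, ContDiff ℂ 1
      fun x : ℂ × (Matrix ι (Fin r) ℂ × Matrix (Fin r) (Fin r) ℂ) => x.2.1 a q := fun a q =>
    contDiff_pi.1 (contDiff_pi.1 (contDiff_fst.comp contDiff_snd) a) q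
  have hC : ∀ a q, ContDiff ℂ 1
      fun x : ℂ × (Matrix ι (Fin r) ℂ × Matrix (Fin r) (Fin r) ℂ) => x.2.2 a q := fun a q =>
    contDiff_pi.1 (contDiff_pi.1 (contDiff_snd.comp contDiff_snd) a) q
  have hF : ContDiff ℂ 1 F := by
    refine ContDiff.prodMk (contDiff_pi.2 fun a => contDiff_pi.2 fun q => ?_)
      (contDiff_pi.2 fun a => contDiff_pi.2 fun q => ?_)
    · simp only [Matrix.sub_apply, scaledDiag, Matrix.diagonal_mul]
      simp only [Matrix.mul_apply, scaledMat, Matrix.of_apply]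
      refine ContDiff.sub (ContDiff.sum fun b _ => ContDiff.mul ?_ (hV b q))
        (ContDiff.mul ?_ (ContDiff.sum fun b _ => (hV a b).mul (hC b q)))
      all_goals fun_prop
    · simp only [Matrix.sub_apply, Matrix.mul_apply]
      exact (ContDiff.sum fun b _ => contDiff_const.mul (hV b q)).sub contDiff_const
  let L : Matrix ι (Fin r) ℂ × Matrix (Fin r) (Fin r) ℂ →
      Matrix ι (Fin r) ℂ × Matrix (Fin r) (Fin r) ℂ := fun v =>
    (scaledMat K B w ρ 0 * v.1 - scaledDiag w ρ 0 * (v.1 * Ω + y₀ * v.2), P * v.1)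
  have hL : ∀ v, HasDerivAt (fun c : ℂ => F (0, (y₀, Ω) + c • v)) (L v) 0 := by
    intro v
    -- For fixed `z` the only nonlinear term is the bilinear `y C`, so along a line `F` is a
    -- quadratic polynomial in `c` without constant term.
    have h1 : (fun c : ℂ => F (0, (y₀, Ω) + c • v)) = fun c : ℂ =>
        c • L v + c ^ 2 • (-(scaledDiag w ρ 0 * (v.1 * v.2)), (0 : Matrix (Fin r) (Fin r) ℂ)) := by
      funext c
      refine Prod.ext ?_ ?_
      · simp only [F, L, Prod.fst_add, Prod.snd_add, Prod.smul_fst, Prod.smul_snd, Matrix.mul_add,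
          Matrix.add_mul, Matrix.mul_smul, Matrix.smul_mul, h0]
        module
      · simp only [F, L, Prod.fst_add, Prod.snd_add, Prod.smul_fst, Prod.smul_snd, Matrix.mul_add,
          Matrix.mul_smul, hP]
        module
    rw [h1]
    have h2 := ((hasDerivAt_id (0 : ℂ)).smul_const (L v)).add
      (((hasDerivAt_id (0 : ℂ)).pow 2).smul_const
        (-(scaledDiag w ρ 0 * (v.1 * v.2)), (0 : Matrix (Fin r) (Fin r) ℂ)))
    simp only [id_eq, one_smul, Nat.add_one_sub_one, mul_zero, zero_mul, zero_smul, add_zero, pow_one] at h2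
    exact h2
  obtain ⟨x, hx, hxO⟩ := exists_implicit_curve F hF (y₀, Ω)
    (by simp [F, h0, hP]) L hL (by
      intro v hv
      simp only [L, Prod.mk_eq_zero, sub_eq_zero] at hv
      obtain ⟨h1, h2⟩ := hinj v.1 v.2 hv.1 hv.2
      exact Prod.ext h1 h2)
  refine ⟨fun z => (x z).1, fun z => (x z).2, ?_, fun a q => ?_, fun a q => ?_⟩
  · filter_upwards [hx] with z hz
    simpa only [F, Prod.mk_eq_zero, sub_eq_zero] using hz
  · refine (Asymptotics.IsBigO.of_bound 1 (Eventually.of_forall fun z => ?_)).trans hxO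
    rw [one_mul]
    exact (Matrix.norm_entry_le_entrywise_sup_norm ((x z).1 - y₀)).trans
      (norm_fst_le (x z - (y₀, Ω)))
  · refine (Asymptotics.IsBigO.of_bound 1 (Eventually.of_forall fun z => ?_)).trans hxO
    rw [one_mul]
    exact (Matrix.norm_entry_le_entrywise_sup_norm ((x z).2 - Ω)).trans
      (norm_snd_le (x z - (y₀, Ω)))

end ScaledPencil

/-! ### Chain indices, weights and block rows -/

section Limit

variable {n k p r : ℕ} {s : ℕ → ℕ}

/-- Index `x` of block size `ρ` as an index of the tail starting at `ρ`. -/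
def tailTop (ρ : BlockSize k) (x : Fin (s ρ.1)) : TailIdx k s ρ.1 := ⟨⟨ρ, le_rfl⟩, x⟩

/-- Inclusion of the tail starting at `ρ + 1` into the tail starting at `ρ`. -/
def tailLift (ρ : BlockSize k) (c : TailIdx k s (ρ.1 + 1)) : TailIdx k s ρ.1 :=
  ⟨⟨c.1.1, (Nat.le_succ _).trans c.1.2⟩, c.2⟩

/-- The first position of a chain in the tail. -/
def tailFirst (p : ℕ) {j : ℕ} (c : TailIdx k s j) : JordanIdx k s ⊕ Fin p :=
  Sum.inl ⟨c.1.1, (firstPos c.1.1, c.2)⟩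

/-- The last position of a chain in the tail. -/
def tailLast (p : ℕ) {j : ℕ} (c : TailIdx k s j) : JordanIdx k s ⊕ Fin p :=
  Sum.inl ⟨c.1.1, (lastPos c.1.1, c.2)⟩

/-- Weights for which `z ^ w` scales the invariant subspace that belongs to block size `ρ`. -/
def weight (s : ℕ → ℕ) (p : ℕ) (ρ : BlockSize k) : JordanIdx k s ⊕ Fin p → ℕ
  | Sum.inl a => if a.1.1 ≤ ρ.1 then ρ.1 - a.1.1 + a.2.1 else min a.2.1 ρ.1
  | Sum.inr _ => ρ.1

/-- The rows of `V` that belong to block size `ρ`. -/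
def rowsOf (ρ : BlockSize k) (V : Matrix (JordanIdx k s ⊕ Fin p) (Fin r) ℂ) :
    Matrix (Fin ρ.1 × Fin (s ρ.1)) (Fin r) ℂ :=
  Matrix.of fun x q => V (Sum.inl ⟨ρ, x⟩) q

/-- The first block rows of `V` for the block sizes from `j` on. -/
def firstRows (j : ℕ) (V : Matrix (JordanIdx k s ⊕ Fin p) (Fin r) ℂ) :
    Matrix (TailIdx k s j) (Fin r) ℂ :=
  Matrix.of fun c q => V (tailFirst p c) q

/-- The perturbation in the basis `[Ξ Ξ_c]`. -/
def pertMat (D : Matrix (Fin n) (Fin n) ℂ) (Xi Sg : Matrix (Fin n) (JordanIdx k s) ℂ)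
    (Xic Sgc : Matrix (Fin n) (Fin p) ℂ) :
    Matrix (JordanIdx k s ⊕ Fin p) (JordanIdx k s ⊕ Fin p) ℂ :=
  (Matrix.fromCols Sg Sgc).conjTranspose * D * Matrix.fromCols Xi Xic

theorem tail_cases (ρ : BlockSize k) (c : TailIdx k s ρ.1) :
    (∃ x, c = tailTop ρ x) ∨ ∃ d, c = tailLift ρ d := by
  obtain ⟨⟨i, hi⟩, x⟩ := c
  rcases Nat.lt_or_eq_of_le hi with h | h
  · exact Or.inr ⟨⟨⟨i, h⟩, x⟩, rfl⟩
  · obtain rfl : ρ = i := Subtype.ext h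
    exact Or.inl ⟨x, rfl⟩

/-- This is the partition behind the 2 × 2 block form of `W_ρ` with lower right block `W_{ρ+1}`. -/
theorem sum_tail (ρ : BlockSize k) (f : TailIdx k s ρ.1 → ℂ) :
    ∑ c, f c = ∑ x, f (tailTop ρ x) + ∑ d, f (tailLift ρ d) := by
  have hb : Function.Bijective (Sum.elim (tailTop (s := s) ρ) (tailLift ρ)) := by
    refine ⟨Function.Injective.sumElim ?_ ?_ ?_, fun c => ?_⟩
    · intro x y h
      simpa [tailTop] using h
    · rintro ⟨⟨i, hi⟩, x⟩ ⟨⟨j, hj⟩, y⟩ h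
      simp only [tailLift, Sigma.mk.injEq, Subtype.mk.injEq] at h
      obtain ⟨rfl, h2⟩ := h
      rw [eq_of_heq h2]
    · rintro x ⟨⟨i, hi⟩, y⟩ h
      have h1 : ρ = i := congrArg (fun c : TailIdx k s ρ.1 => c.1.1) h
      subst h1
      exact absurd hi (by simp)
    · rcases tail_cases ρ c with ⟨x, rfl⟩ | ⟨d, rfl⟩
      · exact ⟨Sum.inl x, rfl⟩
      · exact ⟨Sum.inr d, rfl⟩
  rw [← hb.sum_comp f, Fintype.sum_sum_type]
  rfl

theorem stackI_mul_tailTop (ρ : BlockSize k) (G : Matrix (TailIdx k s (ρ.1 + 1)) (Fin (s ρ.1)) ℂ)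
    (T : Matrix (Fin (s ρ.1)) (Fin r) ℂ) (x : Fin (s ρ.1)) (q : Fin r) :
    (stackI ρ G * T) (tailTop ρ x) q = T x q := by
  have h1 : ∀ y, stackI ρ G (tailTop ρ x) y = if x = y then 1 else 0 := by
    intro y
    simp [stackI, tailTop, Fin.ext_iff]
  simp [Matrix.mul_apply, h1]

theorem stackI_mul_tailLift (ρ : BlockSize k) (G : Matrix (TailIdx k s (ρ.1 + 1)) (Fin (s ρ.1)) ℂ)
    (T : Matrix (Fin (s ρ.1)) (Fin r) ℂ) (d : TailIdx k s (ρ.1 + 1)) (q : Fin r) :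
    (stackI ρ G * T) (tailLift ρ d) q = (G * T) d q := by
  have h1 : ∀ y, stackI ρ G (tailLift ρ d) y = G d y := by
    intro y
    have hd : ρ.1 + 1 ≤ d.1.1.1 := d.1.2
    simp only [stackI, tailLift, Matrix.of_apply]
    rw [dif_pos hd]
  simp [Matrix.mul_apply, h1]

/-! ### The Schur complement `S_ρ` and the matrix `Θ_ρ` -/

section Schur

variable (D : Matrix (Fin n) (Fin n) ℂ) (Xi Sg : Matrix (Fin n) (JordanIdx k s) ℂ) (ρ : BlockSize k)

theorem matW_mul_tailLift (U : Matrix (TailIdx k s ρ.1) (Fin r) ℂ) (d : TailIdx k s (ρ.1 + 1))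
    (q : Fin r) :
    (matW D Xi Sg ρ.1 * U) (tailLift ρ d) q =
      ((lastCols Sg (ρ.1 + 1)).conjTranspose * D * subCol Xi ρ (firstPos ρ) *
        U.submatrix (tailTop ρ) id) d q +
      (matW D Xi Sg (ρ.1 + 1) * U.submatrix (tailLift ρ) id) d q := by
  rw [Matrix.mul_apply, sum_tail]
  rfl

theorem matW_mul_tailTop (U : Matrix (TailIdx k s ρ.1) (Fin r) ℂ) (x : Fin (s ρ.1)) (q : Fin r) :
    (matW D Xi Sg ρ.1 * U) (tailTop ρ x) q =
      ((subCol Sg ρ (lastPos ρ)).conjTranspose * D * subCol Xi ρ (firstPos ρ) *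
        U.submatrix (tailTop ρ) id) x q +
      ((subCol Sg ρ (lastPos ρ)).conjTranspose * D * firstCols Xi (ρ.1 + 1) *
        U.submatrix (tailLift ρ) id) x q := by
  rw [Matrix.mul_apply, sum_tail]
  rfl

variable {D Xi Sg ρ}

theorem matW_mul_matG (hW' : IsUnit (matW D Xi Sg (ρ.1 + 1))) :
    matW D Xi Sg (ρ.1 + 1) * matG D Xi Sg ρ =
      -((lastCols Sg (ρ.1 + 1)).conjTranspose * D * subCol Xi ρ (firstPos ρ)) := by
  rw [matG, Matrix.mul_neg, Matrix.mul_nonsing_inv_cancel_left _ _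
    ((Matrix.isUnit_iff_isUnit_det _).1 hW')]

/-- Vanishing of the lower part of `W_ρ U` determines the lower part of `U`. -/
theorem eq_stackI_mul (hW' : IsUnit (matW D Xi Sg (ρ.1 + 1)))
    {U : Matrix (TailIdx k s ρ.1) (Fin r) ℂ} {T : Matrix (Fin (s ρ.1)) (Fin r) ℂ}
    (hT : ∀ x q, U (tailTop ρ x) q = T x q)
    (hU : ∀ d q, (matW D Xi Sg ρ.1 * U) (tailLift ρ d) q = 0) :
    U = stackI ρ (matG D Xi Sg ρ) * T := by
  have hT' : U.submatrix (tailTop ρ) id = T := Matrix.ext hT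
  have h1 : matW D Xi Sg (ρ.1 + 1) * U.submatrix (tailLift ρ) id =
      matW D Xi Sg (ρ.1 + 1) * (matG D Xi Sg ρ * T) := by
    rw [← Matrix.mul_assoc, matW_mul_matG hW', Matrix.neg_mul, eq_neg_iff_add_eq_zero]
    ext d q
    have := hU d q
    rw [matW_mul_tailLift, hT'] at this
    exact (add_comm _ _).trans this
  have hdet := (Matrix.isUnit_iff_isUnit_det _).1 hW'
  have h2 : U.submatrix (tailLift ρ) id = matG D Xi Sg ρ * T := by
    rw [← Matrix.nonsing_inv_mul_cancel_left (matW D Xi Sg (ρ.1 + 1))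
      (U.submatrix (tailLift ρ) id) hdet, h1, Matrix.nonsing_inv_mul_cancel_left _ _ hdet]
  ext c q
  rcases tail_cases ρ c with ⟨x, rfl⟩ | ⟨d, rfl⟩
  · rw [hT, stackI_mul_tailTop]
  · rw [stackI_mul_tailLift, ← h2]
    rfl

/-- Together with `matW_mul_stackI_tailLift` this is block elimination, `W_ρ [I; G] = [S_ρ; 0]`. -/
theorem matW_mul_stackI_tailTop (T : Matrix (Fin (s ρ.1)) (Fin r) ℂ) (x : Fin (s ρ.1))
    (q : Fin r) :
    (matW D Xi Sg ρ.1 * (stackI ρ (matG D Xi Sg ρ) * T)) (tailTop ρ x) q =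
      (matS D Xi Sg ρ * T) x q := by
  have h1 : (stackI ρ (matG D Xi Sg ρ) * T).submatrix (tailTop ρ) id = T :=
    Matrix.ext fun y q => stackI_mul_tailTop ρ _ T y q
  have h2 : (stackI ρ (matG D Xi Sg ρ) * T).submatrix (tailLift ρ) id = matG D Xi Sg ρ * T :=
    Matrix.ext fun y q => stackI_mul_tailLift ρ _ T y q
  rw [matW_mul_tailTop, h1, h2, matS, Matrix.add_mul, Matrix.add_apply,
    ← Matrix.mul_assoc _ (matG D Xi Sg ρ) T]

theorem matW_mul_stackI_tailLift (hW' : IsUnit (matW D Xi Sg (ρ.1 + 1)))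
    (T : Matrix (Fin (s ρ.1)) (Fin r) ℂ) (d : TailIdx k s (ρ.1 + 1)) (q : Fin r) :
    (matW D Xi Sg ρ.1 * (stackI ρ (matG D Xi Sg ρ) * T)) (tailLift ρ d) q = 0 := by
  have h1 : (stackI ρ (matG D Xi Sg ρ) * T).submatrix (tailTop ρ) id = T :=
    Matrix.ext fun y q => stackI_mul_tailTop ρ _ T y q
  have h2 : (stackI ρ (matG D Xi Sg ρ) * T).submatrix (tailLift ρ) id = matG D Xi Sg ρ * T :=
    Matrix.ext fun y q => stackI_mul_tailLift ρ _ T y q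
  rw [matW_mul_tailLift, h1, h2, ← Matrix.mul_assoc _ (matG D Xi Sg ρ) T, matW_mul_matG hW',
    Matrix.neg_mul, Matrix.neg_apply, add_neg_cancel]

/-- Block rows of `Θ_ρ Ψ`. -/
theorem matTheta_mul_apply (Ψ : Matrix (Fin ρ.1 × Fin (s ρ.1)) (Fin r) ℂ) (m : Fin ρ.1)
    (x : Fin (s ρ.1)) (q : Fin r) :
    (matTheta D Xi Sg ρ * Ψ) (m, x) q =
      if h : m.1 + 1 < ρ.1 then Ψ (⟨m.1 + 1, h⟩, x) q
      else (matS D Xi Sg ρ * topBlock ρ Ψ) x q := by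
  rw [Matrix.mul_apply, Fintype.sum_prod_type]
  split_ifs with h
  · rw [Finset.sum_eq_single ⟨m.1 + 1, h⟩, Finset.sum_eq_single x]
    · simp [matTheta]
    · intro y _ hy
      simp [matTheta, hy.symm]
    · simp
    · intro l _ hl
      refine Finset.sum_eq_zero fun y _ => ?_
      have h1 : ¬ (m.1 + 1 = l.1) := fun hh => hl (Fin.ext hh.symm)
      have h2 : ¬ (m = lastPos ρ) := fun hh => by
        have := congrArg Fin.val hh
        simp only [lastPos] at this
        omega
      simp [matTheta, h1, h2]
    · simp
  · have hm : m = lastPos ρ := by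
      apply Fin.ext
      simp only [lastPos]
      omega
    rw [Finset.sum_eq_single (firstPos ρ), Matrix.mul_apply]
    · refine Finset.sum_congr rfl fun y _ => ?_
      simp [matTheta, hm, topBlock, firstPos]
    · intro l _ hl
      refine Finset.sum_eq_zero fun y _ => ?_
      have h1 : ¬ (m.1 + 1 = l.1) := by omega
      simp [matTheta, h1, hl]
    · simp

/-- `Θ_ρ` is injective, since `S_ρ` is the Schur complement of `W_{ρ+1}` in `W_ρ`. -/
theorem eq_zero_of_matTheta_mul (hW : IsUnit (matW D Xi Sg ρ.1))
    (hW' : IsUnit (matW D Xi Sg (ρ.1 + 1))) {Ψ : Matrix (Fin ρ.1 × Fin (s ρ.1)) (Fin r) ℂ}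
    (h : matTheta D Xi Sg ρ * Ψ = 0) : Ψ = 0 := by
  have hS : matS D Xi Sg ρ * topBlock ρ Ψ = 0 := by
    ext x q
    have h1 := matTheta_mul_apply (D := D) (Xi := Xi) (Sg := Sg) Ψ (lastPos ρ) x q
    rw [h, dif_neg (by have := ρ.pos; simp only [lastPos]; omega)] at h1
    exact h1.symm
  have hWs : matW D Xi Sg ρ.1 * (stackI ρ (matG D Xi Sg ρ) * topBlock ρ Ψ) = 0 := by
    ext c q
    rcases tail_cases ρ c with ⟨x, rfl⟩ | ⟨d, rfl⟩
    · rw [matW_mul_stackI_tailTop, hS]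
      rfl
    · rw [matW_mul_stackI_tailLift hW']
      rfl
  have hdet := (Matrix.isUnit_iff_isUnit_det _).1 hW
  have hst : stackI ρ (matG D Xi Sg ρ) * topBlock ρ Ψ = 0 := by
    rw [← Matrix.nonsing_inv_mul_cancel_left _ (stackI ρ (matG D Xi Sg ρ) * topBlock ρ Ψ) hdet,
      hWs, Matrix.mul_zero]
  -- The first block row of `Ψ` vanishes through the identity block of `stackI`, the later ones
  -- through the superdiagonal identities of `Θ_ρ`.
  ext ⟨⟨m, hm⟩, x⟩ q
  rcases m with _ | m
  · have h1 := stackI_mul_tailTop ρ (matG D Xi Sg ρ) (topBlock ρ Ψ) x q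
    rw [hst] at h1
    exact h1.symm
  · have h1 := matTheta_mul_apply (D := D) (Xi := Xi) (Sg := Sg) Ψ ⟨m, by omega⟩ x q
    rw [h, dif_pos hm] at h1
    exact h1.symm

/-- `Θ_ρ Φ = Φ Ω` determines the block rows of `Φ` from the first one. -/
theorem eq_topBlock_mul_pow {Ω : Matrix (Fin r) (Fin r) ℂ}
    {Φ : Matrix (Fin ρ.1 × Fin (s ρ.1)) (Fin r) ℂ}
    (hΦ : matTheta D Xi Sg ρ * Φ = Φ * Ω) (m : ℕ) (hm : m < ρ.1) (x : Fin (s ρ.1)) (q : Fin r) :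
    Φ (⟨m, hm⟩, x) q = (topBlock ρ Φ * Ω ^ m) x q := by
  induction m generalizing q with
  | zero => simp [topBlock, firstPos]
  | succ m ih =>
    have h1 := matTheta_mul_apply (D := D) (Xi := Xi) (Sg := Sg) Φ ⟨m, by omega⟩ x q
    rw [dif_pos hm] at h1
    rw [← h1, hΦ, pow_succ, ← Matrix.mul_assoc, Matrix.mul_apply, Matrix.mul_apply]
    exact Finset.sum_congr rfl fun c _ => by rw [ih]

/-- A null vector `v` of `Ω` gives `Θ_ρ Φ v = 0`, hence `Φ v = 0` and `v = P Φ v = 0`. Invertibility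
of `Ω` is what determines the rows of chains shorter than `ρ`. -/
theorem det_ne_zero_of_invariant (hW : IsUnit (matW D Xi Sg ρ.1))
    (hW' : IsUnit (matW D Xi Sg (ρ.1 + 1))) {Ω : Matrix (Fin r) (Fin r) ℂ}
    {Φ : Matrix (Fin ρ.1 × Fin (s ρ.1)) (Fin r) ℂ} (hΦ : matTheta D Xi Sg ρ * Φ = Φ * Ω)
    {P : Matrix (Fin r) (Fin ρ.1 × Fin (s ρ.1)) ℂ} (hP : P * Φ = 1) : Ω.det ≠ 0 := by
  intro hdet
  obtain ⟨v, hv, hv0⟩ := Matrix.exists_mulVec_eq_zero_iff.2 hdet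
  have h1 : Ω * Matrix.replicateCol (Fin 1) v = 0 := by
    rw [← Matrix.replicateCol_mulVec, hv0]
    rfl
  have h2 : Φ * Matrix.replicateCol (Fin 1) v = 0 := by
    refine eq_zero_of_matTheta_mul hW hW' ?_
    rw [← Matrix.mul_assoc, hΦ, Matrix.mul_assoc, h1, Matrix.mul_zero]
  have h3 : Matrix.replicateCol (Fin 1) v = 0 := by
    rw [← Matrix.one_mul (Matrix.replicateCol (Fin 1) v), ← hP, Matrix.mul_assoc, h2,
      Matrix.mul_zero]
  exact hv (funext fun a => congrFun (congrFun h3 a) 0)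

end Schur

end Limit

/-! ### The limiting equation at `z = 0` -/

section LimitEquation

variable {n k p r : ℕ} {s : ℕ → ℕ}

theorem nilp_mul_apply (V : Matrix (JordanIdx k s) (Fin r) ℂ) (i : BlockSize k) (m : Fin i.1)
    (x : Fin (s i.1)) (q : Fin r) :
    (nilp k s * V) ⟨i, (m, x)⟩ q =
      if h : m.1 + 1 < i.1 then V ⟨i, (⟨m.1 + 1, h⟩, x)⟩ q else 0 := by
  rw [Matrix.mul_apply, Fintype.sum_sigma, Finset.sum_eq_single i]
  · simp only [nilp, Matrix.blockDiagonal'_apply_eq, Matrix.of_apply]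
    split_ifs with h
    · rw [Finset.sum_eq_single (⟨m.1 + 1, h⟩, x)]
      · simp
      · rintro ⟨l, y⟩ - hne
        rw [if_neg, zero_mul]
        rintro ⟨h1, h2⟩
        exact hne (Prod.ext (Fin.ext h1.symm) h2.symm)
      · simp
    · refine Finset.sum_eq_zero fun y _ => ?_
      rw [if_neg, zero_mul]
      rintro ⟨h1, -⟩
      have h2 := y.1.2
      omega
  · intro j _ hj
    refine Finset.sum_eq_zero fun y _ => ?_
    rw [nilp, Matrix.blockDiagonal'_apply_ne _ _ _ hj.symm, zero_mul]
  · simp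

/-- The shifted unperturbed matrix in the basis `[Ξ Ξ_c]`. -/
def shiftMat (k : ℕ) (s : ℕ → ℕ) (R : Matrix (Fin p) (Fin p) ℂ) :
    Matrix (JordanIdx k s ⊕ Fin p) (JordanIdx k s ⊕ Fin p) ℂ :=
  Matrix.fromBlocks (nilp k s) 0 0 R

theorem shiftMat_mul_inl (R : Matrix (Fin p) (Fin p) ℂ)
    (V : Matrix (JordanIdx k s ⊕ Fin p) (Fin r) ℂ) (i : BlockSize k) (m : Fin i.1)
    (x : Fin (s i.1)) (q : Fin r) :
    (shiftMat k s R * V) (Sum.inl ⟨i, (m, x)⟩) q =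
      if h : m.1 + 1 < i.1 then V (Sum.inl ⟨i, (⟨m.1 + 1, h⟩, x)⟩) q else 0 := by
  rw [Matrix.mul_apply, Fintype.sum_sum_type]
  simp only [shiftMat, Matrix.fromBlocks_apply₁₁, Matrix.fromBlocks_apply₁₂, Matrix.zero_apply,
    zero_mul, Finset.sum_const_zero, add_zero]
  exact nilp_mul_apply (V.submatrix Sum.inl id) i m x q

theorem shiftMat_mul_inr (R : Matrix (Fin p) (Fin p) ℂ)
    (V : Matrix (JordanIdx k s ⊕ Fin p) (Fin r) ℂ) (a : Fin p) (q : Fin r) :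
    (shiftMat k s R * V) (Sum.inr a) q = (R * V.submatrix Sum.inr id) a q := by
  rw [Matrix.mul_apply, Fintype.sum_sum_type]
  simp only [shiftMat, Matrix.fromBlocks_apply₂₁, Matrix.fromBlocks_apply₂₂, Matrix.zero_apply,
    zero_mul, Finset.sum_const_zero, zero_add]
  rfl

/-- This compatibility makes the scaling of `K` independent of `z`. A chain of length `i ≤ ρ` starts
at weight `ρ - i` and ends at `ρ - 1`; longer chains start at `0` and are capped at `ρ`, the
constant weight of the complementary block. -/
theorem weight_of_shiftMat_ne_zero (R : Matrix (Fin p) (Fin p) ℂ) (ρ : BlockSize k)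
    (a b : JordanIdx k s ⊕ Fin p) (h : shiftMat k s R a b ≠ 0) :
    weight s p ρ b = min (weight s p ρ a + 1) ρ.1 := by
  rcases a with ⟨i, m, x⟩ | a <;> rcases b with ⟨j, l, y⟩ | b
  · by_cases hij : i = j
    · subst hij
      simp only [shiftMat, Matrix.fromBlocks_apply₁₁, nilp, Matrix.blockDiagonal'_apply_eq,
        Matrix.of_apply, ne_eq, ite_eq_right_iff, Classical.not_imp] at h
      have h1 := h.1.1
      have h2 := l.2
      simp only [weight]
      split_ifs <;> omega
    · refine (h ?_).elim
      rw [shiftMat, Matrix.fromBlocks_apply₁₁, nilp, Matrix.blockDiagonal'_apply_ne _ _ _ hij]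
  · exact absurd rfl h
  · exact absurd rfl h
  · simp [weight]

theorem weight_tailFirst (ρ : BlockSize k) (c : TailIdx k s ρ.1) :
    weight s p ρ (tailFirst p c) = 0 := by
  have hc : ρ.1 ≤ c.1.1.1 := c.1.2
  simp only [weight, tailFirst, firstPos]
  split_ifs <;> omega

theorem exists_of_weight_eq_zero (ρ : BlockSize k) (b : JordanIdx k s ⊕ Fin p)
    (h : weight s p ρ b = 0) : ∃ c : TailIdx k s ρ.1, tailFirst p c = b := by
  have hρ := ρ.pos
  rcases b with ⟨i, m, x⟩ | b
  · have hm := m.2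
    simp only [weight] at h
    have h1 : ρ.1 ≤ i.1 ∧ m.1 = 0 := by split_ifs at h <;> omega
    refine ⟨⟨⟨i, h1.1⟩, x⟩, ?_⟩
    have h2 : firstPos i = m := Fin.ext h1.2.symm
    simp only [tailFirst, h2]
  · simp only [weight] at h
    omega

theorem tailFirst_injective (j : ℕ) :
    Function.Injective (tailFirst p : TailIdx k s j → JordanIdx k s ⊕ Fin p) := by
  rintro ⟨⟨i, hi⟩, x⟩ ⟨⟨l, hl⟩, y⟩ h
  simp only [tailFirst, Sum.inl.injEq, Sigma.mk.injEq] at h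
  obtain ⟨rfl, h2⟩ := h
  rw [(Prod.mk.inj (eq_of_heq h2)).2]

/-- Weight `0` occurs exactly at the first positions of chains of length at least `ρ`, so the
columns of the perturbation that survive in the limit come from `firstCols`. -/
theorem sum_weight_eq_zero (ρ : BlockSize k) (f : JordanIdx k s ⊕ Fin p → ℂ) :
    ∑ b, (if weight s p ρ b = 0 then f b else 0) = ∑ c : TailIdx k s ρ.1, f (tailFirst p c) := by
  symm
  refine Finset.sum_of_injOn (tailFirst p) (tailFirst_injective _).injOn
    (fun _ _ => Finset.mem_coe.2 (Finset.mem_univ _)) ?_ ?_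
  · intro b _ hb
    rw [if_neg]
    intro h0
    obtain ⟨c, hc⟩ := exists_of_weight_eq_zero ρ b h0
    exact hb ⟨c, by simp, hc⟩
  · intro c _
    rw [if_pos (weight_tailFirst ρ c)]

theorem scaledMat_zero_mul_apply
    (K B : Matrix (JordanIdx k s ⊕ Fin p) (JordanIdx k s ⊕ Fin p) ℂ) (ρ : BlockSize k)
    (V : Matrix (JordanIdx k s ⊕ Fin p) (Fin r) ℂ) (a : JordanIdx k s ⊕ Fin p) (q : Fin r) :
    (scaledMat K B (weight s p ρ) ρ.1 0 * V) a q = (K * V) a q +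
      if ρ.1 ≤ weight s p ρ a + 1 then
        ∑ c : TailIdx k s ρ.1, B a (tailFirst p c) * V (tailFirst p c) q else 0 := by
  simp only [Matrix.mul_apply, scaledMat_zero_apply, add_mul, Finset.sum_add_distrib]
  congr 1
  by_cases ha : ρ.1 ≤ weight s p ρ a + 1
  · rw [if_pos ha, ← sum_weight_eq_zero ρ fun b => B a b * V b q]
    simp [ha]
  · simp [ha]

variable {D : Matrix (Fin n) (Fin n) ℂ} {Xi Sg : Matrix (Fin n) (JordanIdx k s) ℂ}
  {Xic Sgc : Matrix (Fin n) (Fin p) ℂ} {R : Matrix (Fin p) (Fin p) ℂ} {ρ : BlockSize k}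

theorem weight_tailLast (ρ : BlockSize k) (c : TailIdx k s ρ.1) :
    ρ.1 ≤ weight s p ρ (tailLast p c) + 1 := by
  have hc : ρ.1 ≤ c.1.1.1 := c.1.2
  have := c.1.1.pos
  simp only [weight, tailLast, lastPos]
  split_ifs <;> omega

/-- In rows of weight `ρ` the limiting right-hand side vanishes, which produces the homogeneous
equations that define `G_ρ`. -/
theorem weight_tailLast_tailLift (ρ : BlockSize k) (d : TailIdx k s (ρ.1 + 1)) :
    weight s p ρ (tailLast p (tailLift ρ d)) = ρ.1 := by
  have hc : ρ.1 + 1 ≤ d.1.1.1 := d.1.2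
  simp only [weight, tailLast, lastPos, tailLift]
  split_ifs <;> omega

/-- The last row of a chain is zero in `N`, so only the perturbation contributes, through the blocks
`Σ_{ii}* D Ξ_{j1}` with `i, j ≥ ρ`. -/
theorem limit_mul_tailLast (V : Matrix (JordanIdx k s ⊕ Fin p) (Fin r) ℂ) (c : TailIdx k s ρ.1)
    (q : Fin r) :
    (scaledMat (shiftMat k s R) (pertMat D Xi Sg Xic Sgc) (weight s p ρ) ρ.1 0 * V)
      (tailLast p c) q = (matW D Xi Sg ρ.1 * firstRows ρ.1 V) c q := by
  rw [scaledMat_zero_mul_apply, if_pos (weight_tailLast ρ c), tailLast, shiftMat_mul_inl,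
    dif_neg (by have := c.1.1.pos; simp only [lastPos]; omega), zero_add]
  rfl

/-- The first block rows of a solution are determined by those of block size `ρ`. -/
theorem firstRows_eq_stackI (hW' : IsUnit (matW D Xi Sg (ρ.1 + 1)))
    {V : Matrix (JordanIdx k s ⊕ Fin p) (Fin r) ℂ}
    (hV : ∀ d q, (scaledMat (shiftMat k s R) (pertMat D Xi Sg Xic Sgc) (weight s p ρ) ρ.1 0 * V)
      (tailLast p (tailLift ρ d)) q = 0) :
    firstRows ρ.1 V = stackI ρ (matG D Xi Sg ρ) * topBlock ρ (rowsOf ρ V) := by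
  refine eq_stackI_mul hW' (fun x q => rfl) fun d q => ?_
  rw [← limit_mul_tailLast (R := R) (Xic := Xic) (Sgc := Sgc), hV]

/-- On the rows of block size `ρ` the limiting matrix acts as `Θ_ρ`. -/
theorem rowsOf_limit_mul (hW' : IsUnit (matW D Xi Sg (ρ.1 + 1)))
    {V : Matrix (JordanIdx k s ⊕ Fin p) (Fin r) ℂ}
    (hV : ∀ d q, (scaledMat (shiftMat k s R) (pertMat D Xi Sg Xic Sgc) (weight s p ρ) ρ.1 0 * V)
      (tailLast p (tailLift ρ d)) q = 0) :
    rowsOf ρ (scaledMat (shiftMat k s R) (pertMat D Xi Sg Xic Sgc) (weight s p ρ) ρ.1 0 * V) =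
      matTheta D Xi Sg ρ * rowsOf ρ V := by
  ext ⟨m, x⟩ q
  rw [matTheta_mul_apply]
  split_ifs with h
  · simp only [rowsOf, Matrix.of_apply]
    rw [scaledMat_zero_mul_apply, shiftMat_mul_inl, dif_pos h, if_neg, add_zero]
    simp only [weight, le_refl, if_true]
    omega
  · have hm : m = lastPos ρ := by
      apply Fin.ext
      simp only [lastPos]
      omega
    subst hm
    rw [← matW_mul_stackI_tailTop, ← firstRows_eq_stackI hW' hV]
    exact limit_mul_tailLast V (tailTop ρ x) q

theorem row_eq_zero_of_mul {α : Type*} {Ω : Matrix (Fin r) (Fin r) ℂ} (hΩ : Ω.det ≠ 0)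
    {V : Matrix α (Fin r) ℂ} {a : α} (h : ∀ q, (V * Ω) a q = 0) (q : Fin r) : V a q = 0 := by
  have h1 : V = V * Ω * Ω⁻¹ := (Matrix.mul_nonsing_inv_cancel_right _ _ hΩ.isUnit).symm
  rw [h1, Matrix.mul_apply]
  exact Finset.sum_eq_zero fun c _ => by rw [h, zero_mul]

/-- A homogeneous solution that vanishes on the rows of block size `ρ` is trivial. -/
theorem eq_zero_of_limit_eq (hW' : IsUnit (matW D Xi Sg (ρ.1 + 1))) (hR : R.det ≠ 0)
    {Ω : Matrix (Fin r) (Fin r) ℂ} (hΩ : Ω.det ≠ 0)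
    {V : Matrix (JordanIdx k s ⊕ Fin p) (Fin r) ℂ} (hρ : rowsOf ρ V = 0)
    (hV : ∀ a, (∀ x, a ≠ Sum.inl ⟨ρ, x⟩) → ∀ q,
      (scaledMat (shiftMat k s R) (pertMat D Xi Sg Xic Sgc) (weight s p ρ) ρ.1 0 * V) a q =
        if weight s p ρ a < ρ.1 then (V * Ω) a q else 0) : V = 0 := by
  have hne : ∀ (i : BlockSize k) (y : Fin i.1 × Fin (s i.1)), i.1 ≠ ρ.1 →
      ∀ x, (Sum.inl ⟨i, y⟩ : JordanIdx k s ⊕ Fin p) ≠ Sum.inl ⟨ρ, x⟩ := by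
    intro i y hi x hx
    exact hi (congrArg (fun c : JordanIdx k s => c.1.1) (Sum.inl.inj hx))
  have htail : ∀ d q, (scaledMat (shiftMat k s R) (pertMat D Xi Sg Xic Sgc) (weight s p ρ) ρ.1 0 * V)
      (tailLast p (tailLift ρ d)) q = 0 := by
    intro d q
    have hd : ρ.1 + 1 ≤ d.1.1.1 := d.1.2
    rw [hV, weight_tailLast_tailLift, if_neg (lt_irrefl _)]
    exact hne _ _ (by simp only [tailLift]; omega)
  have hfirst : ∀ (c : TailIdx k s ρ.1) q, V (tailFirst p c) q = 0 := by
    intro c q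
    have h1 := firstRows_eq_stackI hW' htail
    rw [hρ] at h1
    have h2 : topBlock ρ (0 : Matrix (Fin ρ.1 × Fin (s ρ.1)) (Fin r) ℂ) = 0 := rfl
    rw [h2, Matrix.mul_zero] at h1
    exact congrFun (congrFun h1 c) q
  have hK : ∀ a, (∀ x, a ≠ Sum.inl ⟨ρ, x⟩) → ∀ q, (shiftMat k s R * V) a q =
      if weight s p ρ a < ρ.1 then (V * Ω) a q else 0 := by
    intro a ha q
    rw [← hV a ha, scaledMat_zero_mul_apply]
    simp [hfirst]
  have hrow : ∀ (i : BlockSize k) (m : ℕ) (hm : m < i.1) (x : Fin (s i.1)) (q : Fin r),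
      V (Sum.inl ⟨i, (⟨m, hm⟩, x)⟩) q = 0 := by
    intro i
    rcases lt_trichotomy i.1 ρ.1 with hi | hi | hi
    -- Short chains have all weights below `ρ`, so each row, times `Ω`, equals the next row, or zero
    -- at the end. Induction runs backwards from the last row, `l` being the distance to it.
    · have key : ∀ (l m : ℕ) (hm : m < i.1), m + l + 1 = i.1 → ∀ (x : Fin (s i.1)) (q : Fin r),
          V (Sum.inl ⟨i, (⟨m, hm⟩, x)⟩) q = 0 := by
        intro l
        induction l with
        | zero =>
          intro m hm hl x
          refine row_eq_zero_of_mul hΩ fun q => ?_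
          have h1 := hK (Sum.inl ⟨i, (⟨m, hm⟩, x)⟩) (hne _ _ hi.ne) q
          rw [shiftMat_mul_inl, dif_neg (by simp only; omega), if_pos] at h1
          · exact h1.symm
          · simp only [weight, hi.le, if_true]
            omega
        | succ l ih =>
          intro m hm hl x
          refine row_eq_zero_of_mul hΩ fun q => ?_
          have h1 := hK (Sum.inl ⟨i, (⟨m, hm⟩, x)⟩) (hne _ _ hi.ne) q
          rw [shiftMat_mul_inl, dif_pos (by simp only; omega), if_pos,
            ih (m + 1) (by omega) (by omega)] at h1
          · exact h1.symm
          · simp only [weight, hi.le, if_true]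
            omega
      exact fun m hm => key (i.1 - 1 - m) m hm (by omega)
    · obtain rfl : i = ρ := Subtype.ext hi
      exact fun m hm x q => congrFun (congrFun hρ (⟨m, hm⟩, x)) q
    -- Long chains are treated forwards: the first row vanishes by `hfirst`, and each next row is
    -- the previous one times `Ω`, or zero.
    · intro m
      induction m with
      | zero => exact fun hm x q => hfirst ⟨⟨i, hi.le⟩, x⟩ q
      | succ m ih =>
        intro hm x q
        have h1 := hK (Sum.inl ⟨i, (⟨m, by omega⟩, x)⟩) (hne _ _ hi.ne') q
        rw [shiftMat_mul_inl, dif_pos hm] at h1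
        have h2 : (V * Ω) (Sum.inl ⟨i, (⟨m, by omega⟩, x)⟩) q = 0 := by
          rw [Matrix.mul_apply]
          exact Finset.sum_eq_zero fun c _ => by rw [ih, zero_mul]
        rw [h2, ite_self] at h1
        exact h1
  have hc : V.submatrix Sum.inr id = (0 : Matrix (Fin p) (Fin r) ℂ) := by
    have h1 : R * V.submatrix Sum.inr id = (0 : Matrix (Fin p) (Fin r) ℂ) := by
      ext a q
      rw [← shiftMat_mul_inr, hK _ (by simp)]
      simp [weight]
    rw [← Matrix.nonsing_inv_mul_cancel_left R (V.submatrix Sum.inr id) hR.isUnit, h1,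
      Matrix.mul_zero]
  ext a q
  rcases a with ⟨i, ⟨m, hm⟩, x⟩ | a
  · exact hrow i m hm x q
  · exact congrFun (congrFun hc a) q

/-- Solution of the limiting equation that extends `Φ`. -/
theorem exists_limit_solution (hW' : IsUnit (matW D Xi Sg (ρ.1 + 1))) (hR : R.det ≠ 0)
    {Ω : Matrix (Fin r) (Fin r) ℂ} (hΩ : Ω.det ≠ 0)
    (Φ : Matrix (Fin ρ.1 × Fin (s ρ.1)) (Fin r) ℂ) :
    ∃ V : Matrix (JordanIdx k s ⊕ Fin p) (Fin r) ℂ, rowsOf ρ V = Φ ∧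
      ∀ a, (∀ x, a ≠ Sum.inl ⟨ρ, x⟩) → ∀ q,
        (scaledMat (shiftMat k s R) (pertMat D Xi Sg Xic Sgc) (weight s p ρ) ρ.1 0 * V) a q =
          if weight s p ρ a < ρ.1 then (V * Ω) a q else 0 := by
  classical
  set M := scaledMat (shiftMat k s R) (pertMat D Xi Sg Xic Sgc) (weight s p ρ) ρ.1 0
  -- Prescribed rows on block size `ρ` and equation defects on all other rows form a square linear
  -- system, so uniqueness (`eq_zero_of_limit_eq`) yields existence.
  let f : Matrix (JordanIdx k s ⊕ Fin p) (Fin r) ℂ →ₗ[ℂ]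
      Matrix (JordanIdx k s ⊕ Fin p) (Fin r) ℂ :=
    { toFun := fun V => Matrix.of fun a q => if ∃ x, a = Sum.inl ⟨ρ, x⟩ then V a q else
        (M * V) a q - if weight s p ρ a < ρ.1 then (V * Ω) a q else 0
      map_add' := fun V V' => by
        ext a q
        simp only [Matrix.mul_add, Matrix.add_mul, Matrix.add_apply, Matrix.of_apply]
        split_ifs <;> ring
      map_smul' := fun c V => by
        ext a q
        simp only [Matrix.mul_smul, Matrix.smul_mul, Matrix.smul_apply, Matrix.of_apply,
          RingHom.id_apply, smul_eq_mul]
        split_ifs <;> ring }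
  have hpos : ∀ V x q, f V (Sum.inl ⟨ρ, x⟩) q = V (Sum.inl ⟨ρ, x⟩) q := fun V x q =>
    if_pos ⟨x, rfl⟩
  have hneg : ∀ V a q, (∀ x, a ≠ Sum.inl ⟨ρ, x⟩) → f V a q =
      (M * V) a q - if weight s p ρ a < ρ.1 then (V * Ω) a q else 0 := fun V a q h =>
    if_neg (by rintro ⟨x, hx⟩; exact h x hx)
  have hinj : Function.Injective f := by
    rw [injective_iff_map_eq_zero]
    intro V hV
    refine eq_zero_of_limit_eq (D := D) (Xi := Xi) (Sg := Sg) (Xic := Xic) (Sgc := Sgc) hW' hR hΩ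
      (ρ := ρ) ?_ fun a ha q => ?_
    · ext x q
      have := hpos V x q
      rw [hV] at this
      exact this.symm
    · have := hneg V a q ha
      rw [hV] at this
      exact sub_eq_zero.1 this.symm
  obtain ⟨V, hV⟩ := LinearMap.injective_iff_surjective.1 hinj
    (Matrix.of fun a q => Function.extend
      (fun x => (Sum.inl ⟨ρ, x⟩ : JordanIdx k s ⊕ Fin p)) (fun x => Φ x q) 0 a)
  have hi : Function.Injective (fun x => (Sum.inl ⟨ρ, x⟩ : JordanIdx k s ⊕ Fin p)) := by
    intro x y h
    simpa using h
  refine ⟨V, ?_, fun a ha q => ?_⟩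
  · ext x q
    have := hpos V x q
    rw [hV, Matrix.of_apply, hi.extend_apply] at this
    exact this.symm
  · have := hneg V a q ha
    rw [hV, Matrix.of_apply, Function.extend_apply'] at this
    · exact sub_eq_zero.1 this.symm
    · rintro ⟨x, hx⟩
      exact ha x hx.symm

end LimitEquation

/-! ### Continuation of the limit solution and orders in `t` -/

section Assembly

variable {n k p r : ℕ} {s : ℕ → ℕ}

/-- The scaled solution and the limiting data it continues. -/
theorem exists_scaled_continuation {D : Matrix (Fin n) (Fin n) ℂ}
    {Xi Sg : Matrix (Fin n) (JordanIdx k s) ℂ} {Xic Sgc : Matrix (Fin n) (Fin p) ℂ}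
    {R : Matrix (Fin p) (Fin p) ℂ} (hR : R.det ≠ 0) {ρ : BlockSize k}
    (hW : IsUnit (matW D Xi Sg ρ.1)) (hW' : IsUnit (matW D Xi Sg (ρ.1 + 1)))
    {Ω : Matrix (Fin r) (Fin r) ℂ} {Φ : Matrix (Fin ρ.1 × Fin (s ρ.1)) (Fin r) ℂ}
    (hrank : Φ.rank = r) (hΦ : matTheta D Xi Sg ρ * Φ = Φ * Ω)
    (hsep : ∀ μ ∈ Ω.charpoly.roots,
      μ ∉ (matTheta D Xi Sg ρ).charpoly.roots - Ω.charpoly.roots) :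
    ∃ (P : Matrix (Fin r) (JordanIdx k s ⊕ Fin p) ℂ)
      (y₀ : Matrix (JordanIdx k s ⊕ Fin p) (Fin r) ℂ)
      (y : ℂ → Matrix (JordanIdx k s ⊕ Fin p) (Fin r) ℂ) (C : ℂ → Matrix (Fin r) (Fin r) ℂ),
      rowsOf ρ y₀ = Φ ∧
      firstRows ρ.1 y₀ = stackI ρ (matG D Xi Sg ρ) * topBlock ρ Φ ∧
      (∀ᶠ z in 𝓝 (0 : ℂ),
        (shiftMat k s R + z ^ ρ.1 • pertMat D Xi Sg Xic Sgc) *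
            (Matrix.diagonal (fun a => z ^ weight s p ρ a) * y z) =
          Matrix.diagonal (fun a => z ^ weight s p ρ a) * y z * (z • C z) ∧ P * y z = 1) ∧
      (∀ a q, (fun z => y z a q - y₀ a q) =O[𝓝 (0 : ℂ)] fun z => z) ∧
      ∀ a q, (fun z => C z a q - Ω a q) =O[𝓝 (0 : ℂ)] fun z => z := by
  obtain ⟨P₀, hP₀, hV₀⟩ := exists_leftInverse_of_separated _ Ω Φ hrank hΦ hsep
  have hΩ := det_ne_zero_of_invariant hW hW' hΦ hP₀
  obtain ⟨y₀, hy₀, hy₀'⟩ := exists_limit_solution (Xic := Xic) (Sgc := Sgc) hW' hR hΩ Φ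
  set M := scaledMat (shiftMat k s R) (pertMat D Xi Sg Xic Sgc) (weight s p ρ) ρ.1 0 with hM
  have hne : ∀ (d : TailIdx k s (ρ.1 + 1)) x, tailLast p (tailLift ρ d) ≠ Sum.inl ⟨ρ, x⟩ := by
    intro d x hx
    have hd : ρ.1 + 1 ≤ d.1.1.1 := d.1.2
    have h1 : d.1.1.1 = ρ.1 := congrArg (fun c : JordanIdx k s => c.1.1) (Sum.inl.inj hx)
    omega
  have htail : ∀ d q, (M * y₀) (tailLast p (tailLift ρ d)) q = 0 := by
    intro d q
    rw [hy₀' _ (hne d), weight_tailLast_tailLift, if_neg (lt_irrefl _)]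
  have hwρ : ∀ x : Fin ρ.1 × Fin (s ρ.1), weight s p ρ (Sum.inl ⟨ρ, x⟩) < ρ.1 := by
    intro x
    have := x.1.2
    simp only [weight, le_refl, if_true]
    omega
  let E : Matrix (Fin ρ.1 × Fin (s ρ.1)) (JordanIdx k s ⊕ Fin p) ℂ :=
    (1 : Matrix (JordanIdx k s ⊕ Fin p) (JordanIdx k s ⊕ Fin p) ℂ).submatrix
      (fun x => Sum.inl ⟨ρ, x⟩) id
  have hE : ∀ V : Matrix (JordanIdx k s ⊕ Fin p) (Fin r) ℂ, E * V = rowsOf ρ V := by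
    intro V
    ext x q
    simp [E, rowsOf, Matrix.mul_apply, Matrix.one_apply]
  have hlim : M * y₀ = scaledDiag (weight s p ρ) ρ.1 0 * (y₀ * Ω) := by
    ext a q
    rw [scaledDiag_zero_mul_apply]
    by_cases ha : ∃ x, a = Sum.inl ⟨ρ, x⟩
    · obtain ⟨x, rfl⟩ := ha
      rw [if_pos (hwρ x)]
      have h1 := congrFun (congrFun (rowsOf_limit_mul hW' htail) x) q
      rw [hy₀, hΦ] at h1
      refine h1.trans ?_
      rw [← hy₀]
      rfl
    · exact hy₀' a (fun x hx => ha ⟨x, hx⟩) q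
  obtain ⟨y, C, hyC, hy, hC⟩ := exists_scaled_solution (shiftMat k s R)
    (pertMat D Xi Sg Xic Sgc) (weight s p ρ) ρ.1 (P₀ * E) y₀ Ω
    (by rw [Matrix.mul_assoc, hE, hy₀, hP₀]) hlim (by
      intro V C hV hPV
      rw [Matrix.mul_assoc, hE] at hPV
      rw [← hM] at hV
      have htailV : ∀ d q, (M * V) (tailLast p (tailLift ρ d)) q = 0 := by
        intro d q
        rw [hV, scaledDiag_zero_mul_apply, weight_tailLast_tailLift, if_neg (lt_irrefl _)]
      -- Separation turns this into `rowsOf ρ V = Φ P₀ (rowsOf ρ V)`, which is zero by the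
      -- normalization; then `Φ C = 0`, and `P₀` gives `C = 0`.
      have hΘV : matTheta D Xi Sg ρ * rowsOf ρ V - rowsOf ρ V * Ω = Φ * C := by
        rw [← rowsOf_limit_mul hW' htailV, sub_eq_iff_eq_add', ← hM, hV]
        ext x q
        simp only [rowsOf, Matrix.of_apply]
        rw [scaledDiag_zero_mul_apply, if_pos (hwρ x), ← hy₀]
        rfl
      have hρV : rowsOf ρ V = 0 := by
        rw [hV₀ _ C hΘV, hPV, Matrix.mul_zero]
      have hC0 : C = 0 := by
        rw [hρV, Matrix.mul_zero, Matrix.zero_mul, sub_zero] at hΘV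
        rw [← Matrix.one_mul C, ← hP₀, Matrix.mul_assoc, ← hΘV, Matrix.mul_zero]
      refine ⟨eq_zero_of_limit_eq (D := D) (Xi := Xi) (Sg := Sg) (Xic := Xic) (Sgc := Sgc) hW' hR hΩ
        hρV fun a _ q => ?_, hC0⟩
      rw [← hM, hV, scaledDiag_zero_mul_apply, hC0, Matrix.mul_zero, add_zero])
  refine ⟨P₀ * E, y₀, y, C, hy₀, ?_, ?_, hy, hC⟩
  · rw [firstRows_eq_stackI hW' htail, hy₀]
  · filter_upwards [hyC] with z hz
    exact ⟨mul_diagonal_of_scaled (weight_of_shiftMat_ne_zero R ρ) hz.1, hz.2⟩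

theorem rank_eq_of_leftInverse {α : Type*} [Fintype α] {H : Matrix α (Fin r) ℂ}
    {L : Matrix (Fin r) α ℂ} (h : L * H = 1) : H.rank = r := by
  refine le_antisymm (by simpa using Matrix.rank_le_card_width H) ?_
  have h1 := Matrix.rank_mul_le_right L H
  rwa [h, Matrix.rank_one, Fintype.card_fin] at h1

/-- Real powers of `t` absorb integral powers of `t ^ (1 / ρ)`. -/
theorem isBigO_pow_mul {f : ℝ → ℂ} {c : ℝ} (ρ m : ℕ) (hf : f =O[𝓝[>] (0 : ℝ)] fun t : ℝ => t ^ c) :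
    (fun t : ℝ => ((t ^ (1 / (ρ : ℝ)) : ℝ) : ℂ) ^ m * f t) =O[𝓝[>] (0 : ℝ)]
      fun t : ℝ => t ^ ((m : ℝ) / ρ + c) := by
  have h1 : (fun t : ℝ => ((t ^ (1 / (ρ : ℝ)) : ℝ) : ℂ) ^ m) =O[𝓝[>] (0 : ℝ)]
      fun t : ℝ => t ^ ((m : ℝ) / ρ) := by
    refine Asymptotics.IsBigO.of_bound 1 ?_
    filter_upwards [self_mem_nhdsWithin] with t ht
    have ht0 : (0 : ℝ) < t := ht
    rw [one_mul, ← Complex.ofReal_pow, Complex.norm_real, ← Real.rpow_natCast, ← Real.rpow_mul ht0.le]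
    apply le_of_eq
    congr 2
    ring
  refine (h1.mul hf).congr' EventuallyEq.rfl ?_
  filter_upwards [self_mem_nhdsWithin] with t ht
  exact (Real.rpow_add ht _ _).symm

theorem tendsto_root (ρ : BlockSize k) :
    Tendsto (fun t : ℝ => ((t ^ (1 / (ρ.1 : ℝ)) : ℝ) : ℂ)) (𝓝[>] (0 : ℝ)) (𝓝 0) := by
  have hρ : (0 : ℝ) < 1 / (ρ.1 : ℝ) := by
    have : (0 : ℝ) < ρ.1 := by exact_mod_cast ρ.pos
    positivity
  have h1 : Tendsto (fun t : ℝ => t ^ (1 / (ρ.1 : ℝ))) (𝓝 (0 : ℝ)) (𝓝 0) := by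
    have h2 := (Real.continuousAt_rpow_const (0 : ℝ) _ (Or.inr hρ.le)).tendsto
    rwa [Real.zero_rpow hρ.ne'] at h2
  exact (Complex.continuous_ofReal.tendsto' 0 0 Complex.ofReal_zero).comp
    (h1.mono_left nhdsWithin_le_nhds)

theorem isBigO_comp_root (ρ : BlockSize k) {f : ℂ → ℂ} (hf : f =O[𝓝 (0 : ℂ)] fun z => z) :
    (fun t : ℝ => f ((t ^ (1 / (ρ.1 : ℝ)) : ℝ) : ℂ)) =O[𝓝[>] (0 : ℝ)]
      fun t : ℝ => t ^ (1 / (ρ.1 : ℝ)) := by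
  refine (hf.comp_tendsto (tendsto_root ρ)).trans ?_
  exact Asymptotics.isBigO_of_le _ fun t => by simp only [Function.comp, Complex.norm_real, le_refl]

theorem isBigO_comp_root_const (ρ : BlockSize k) {f : ℂ → ℂ} {c : ℂ}
    (hf : (fun z => f z - c) =O[𝓝 (0 : ℂ)] fun z => z) :
    (fun t : ℝ => f ((t ^ (1 / (ρ.1 : ℝ)) : ℝ) : ℂ)) =O[𝓝[>] (0 : ℝ)]
      fun t : ℝ => t ^ (0 : ℝ) := by
  have h1 : Tendsto f (𝓝 0) (𝓝 c) := by
    simpa using (hf.trans_tendsto tendsto_id).add_const c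
  simp only [Real.rpow_zero]
  exact (h1.comp (tendsto_root ρ)).isBigO_one ℝ

/-- The leading term together with the correction blocks is the part of `[Ξ Ξ_c] Y` in the range
of `Ξ`. -/
theorem leading_add_sum_blockCol (Xi : Matrix (Fin n) (JordanIdx k s) ℂ) (ρ : BlockSize k)
    (Y y₀ : Matrix (JordanIdx k s ⊕ Fin p) (Fin r) ℂ) :
    firstCols Xi ρ.1 * firstRows ρ.1 y₀ +
      ∑ i : BlockSize k, blockCol Xi i * (Matrix.of fun x q => Y (Sum.inl ⟨i, x⟩) q -
        if weight s p ρ (Sum.inl ⟨i, x⟩) = 0 then y₀ (Sum.inl ⟨i, x⟩) q else 0) =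
      Xi * Y.submatrix Sum.inl id := by
  ext a q
  have h1 : (firstCols Xi ρ.1 * firstRows ρ.1 y₀) a q = ∑ b : JordanIdx k s,
      if weight s p ρ (Sum.inl b) = 0 then Xi a b * y₀ (Sum.inl b) q else 0 := by
    have h2 := sum_weight_eq_zero (p := p) ρ
      (Sum.elim (fun b => Xi a b * y₀ (Sum.inl b) q) 0)
    rw [Fintype.sum_sum_type] at h2
    simp only [Sum.elim_inl, Sum.elim_inr, Pi.zero_apply, ite_self, Finset.sum_const_zero,
      add_zero] at h2
    rw [h2]
    rfl
  rw [Matrix.add_apply, Matrix.sum_apply, h1, Matrix.mul_apply]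
  simp only [Matrix.mul_apply, Matrix.of_apply, blockCol, Matrix.submatrix_apply, id]
  rw [Fintype.sum_sigma, Fintype.sum_sigma, ← Finset.sum_add_distrib]
  refine Finset.sum_congr rfl fun i _ => ?_
  rw [← Finset.sum_add_distrib]
  refine Finset.sum_congr rfl fun x _ => ?_
  split_ifs <;> ring

end Assembly

end JordanPert

/-! ### The expansions of `C` and `H` -/

theorem theorem3p2 {n p k r : ℕ} (s : ℕ → ℕ) (_hsk : 0 < s k)
    (A D : Matrix (Fin n) (Fin n) ℂ) (lam : ℂ)
    (Xi Sg : Matrix (Fin n) (JordanIdx k s) ℂ) (Xic Sgc : Matrix (Fin n) (Fin p) ℂ)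
    (A22 : Matrix (Fin p) (Fin p) ℂ)
    -- `[Ξ Ξ_c]` is invertible and the adjoint of `[Σ Σ_c]` is its inverse
    (hinv : Matrix.fromCols Xi Xic * (Matrix.fromCols Sg Sgc).conjTranspose = 1)
    (hinv' : (Matrix.fromCols Sg Sgc).conjTranspose * Matrix.fromCols Xi Xic = 1)
    -- block diagonal form of `A`, with the modified Jordan form in the first block
    (hA : A * Matrix.fromCols Xi Xic =
      Matrix.fromCols Xi Xic * Matrix.fromBlocks (lam • 1 + nilp k s) 0 0 A22)
    (hlam : lam ∉ spectrum ℂ A22)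
    (ρ : BlockSize k)
    -- generic condition; the second part is void for `ρ = k`
    (hW : IsUnit (matW D Xi Sg ρ.1)) (hW' : IsUnit (matW D Xi Sg (ρ.1 + 1)))
    -- `Φ` is a basis matrix of an invariant subspace of `Θ_ρ` on which `Θ_ρ` acts as `Ω`
    (Ω : Matrix (Fin r) (Fin r) ℂ) (Φ : Matrix (Fin ρ.1 × Fin (s ρ.1)) (Fin r) ℂ)
    (hrank : Φ.rank = r) (hΦ : matTheta D Xi Sg ρ * Φ = Φ * Ω)
    -- the eigenvalues of `Ω` differ from the remaining ones of `Θ_ρ` (counted with multiplicity)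
    (hsep : ∀ μ ∈ Ω.charpoly.roots,
      μ ∉ (matTheta D Xi Sg ρ).charpoly.roots - Ω.charpoly.roots) :
    ∃ (H : ℝ → Matrix (Fin n) (Fin r) ℂ) (C : ℝ → Matrix (Fin r) (Fin r) ℂ)
      (Hb : (i : BlockSize k) → ℝ → Matrix (Fin i.1 × Fin (s i.1)) (Fin r) ℂ),
      (∀ᶠ t : ℝ in 𝓝[>] (0 : ℝ), (A + (t : ℂ) • D) * H t = H t * C t ∧ (H t).rank = r) ∧
      MatBigO (fun t => C t - (lam • 1 + ((t ^ (1 / (ρ.1 : ℝ)) : ℝ) : ℂ) • Ω)) (2 / (ρ.1 : ℝ)) ∧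
      MatBigO (fun t => H t - (firstCols Xi ρ.1 * stackI ρ (matG D Xi Sg ρ) * topBlock ρ Φ +
        ∑ i : BlockSize k, blockCol Xi i * Hb i t)) 1 ∧
      -- block rows of `H_ρ`
      (∀ m : Fin ρ.1, MatBigO
        (fun t => blockRow (Hb ρ t) m -
          if (m : ℕ) = 0 then 0
          else topBlock ρ Φ * (((t ^ (1 / (ρ.1 : ℝ)) : ℝ) : ℂ) • Ω) ^ (m : ℕ))
        (((m : ℝ) + 1) / (ρ.1 : ℝ))) ∧
      -- block rows of `H_i`, `i < ρ`: orders `t^{1-i/ρ}, t^{1-(i-1)/ρ}, …, t^{1-1/ρ}`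
      (∀ i : BlockSize k, i.1 < ρ.1 → ∀ m : Fin i.1,
        MatBigO (fun t => blockRow (Hb i t) m) (1 - ((i.1 : ℝ) - (m : ℝ)) / (ρ.1 : ℝ))) ∧
      -- block rows of `H_i`, `i > ρ`: orders `t^{1/ρ}, t^{1/ρ}, t^{2/ρ}, …, t^{1-1/ρ}, t, …, t`
      (∀ i : BlockSize k, ρ.1 < i.1 → ∀ m : Fin i.1,
        MatBigO (fun t => blockRow (Hb i t) m)
          ((max 1 (min (m : ℕ) ρ.1) : ℕ) / (ρ.1 : ℝ))) := by
  have hρ0 : (ρ.1 : ℝ) ≠ 0 := by exact_mod_cast ρ.pos.ne'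
  set R : Matrix (Fin p) (Fin p) ℂ := A22 - lam • 1 with hRdef
  have hR : R.det ≠ 0 := by
    rw [spectrum.notMem_iff, Algebra.algebraMap_eq_smul_one] at hlam
    have h1 : IsUnit R := by
      rw [hRdef, ← neg_sub]
      exact hlam.neg
    exact ((Matrix.isUnit_iff_isUnit_det _).1 h1).ne_zero
  obtain ⟨P, y₀, y, C, hy₀, hfirst, hyC, hy, hC⟩ := exists_scaled_continuation
    (Xic := Xic) (Sgc := Sgc) hR hW hW' hrank hΦ hsep
  set X := Matrix.fromCols Xi Xic with hX
  have hAX : ∀ c : ℂ, (A + c • D) * X =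
      X * (lam • 1 + (shiftMat k s R + c • pertMat D Xi Sg Xic Sgc)) := by
    intro c
    have h1 : Matrix.fromBlocks (lam • 1 + nilp k s) 0 0 A22 = lam • 1 + shiftMat k s R := by
      rw [shiftMat, ← Matrix.fromBlocks_one, Matrix.fromBlocks_smul, Matrix.fromBlocks_add, hRdef]
      simp
    have h2 : X * pertMat D Xi Sg Xic Sgc = D * X := by
      rw [pertMat, ← Matrix.mul_assoc, ← Matrix.mul_assoc, hinv, Matrix.one_mul]
    rw [Matrix.add_mul, hA, h1, ← add_assoc, Matrix.mul_add _ (_ + _), Matrix.mul_smul, h2,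
      Matrix.smul_mul]
  let z : ℝ → ℂ := fun t => ((t ^ (1 / (ρ.1 : ℝ)) : ℝ) : ℂ)
  have hz : ∀ t : ℝ, 0 < t → z t ^ ρ.1 = (t : ℂ) ∧ z t ≠ 0 := by
    intro t ht
    constructor
    · simp only [z]
      rw [← Complex.ofReal_pow, ← Real.rpow_natCast, ← Real.rpow_mul ht.le, one_div_mul_cancel hρ0,
        Real.rpow_one]
    · exact Complex.ofReal_ne_zero.2 (Real.rpow_pos_of_pos ht _).ne'
  let w := weight s p ρ
  let Y : ℝ → Matrix (JordanIdx k s ⊕ Fin p) (Fin r) ℂ := fun t =>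
    Matrix.diagonal (fun a => z t ^ w a) * y (z t)
  have hYapp : ∀ t a q, Y t a q = z t ^ w a * y (z t) a q := fun t a q => Matrix.diagonal_mul _ _ _ _
  -- `hYO` uses only that `y` stays bounded; `hYO'` gains a factor `t^(1/ρ)` from `y - y₀ = O(z)`.
  have hYO : ∀ a q, (fun t => Y t a q) =O[𝓝[>] (0 : ℝ)] fun t : ℝ => t ^ ((w a : ℝ) / ρ.1) := by
    intro a q
    simpa only [hYapp, add_zero] using isBigO_pow_mul ρ.1 (w a) (isBigO_comp_root_const ρ (hy a q))
  have hYO' : ∀ a q, (fun t => z t ^ w a * (y (z t) a q - y₀ a q)) =O[𝓝[>] (0 : ℝ)]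
      fun t : ℝ => t ^ (((w a : ℝ) + 1) / ρ.1) := by
    intro a q
    simpa only [add_div] using isBigO_pow_mul ρ.1 (w a) (isBigO_comp_root ρ (hy a q))
  -- The limit is subtracted from the correction blocks only in rows of weight `0`, since these rows
  -- of `y₀` make up the leading term `Ξ̃_ρ [I; G] Q₁`.
  refine ⟨fun t => X * Y t, fun t => lam • 1 + z t • C (z t),
    fun i t => Matrix.of fun x q => Y t (Sum.inl ⟨i, x⟩) q -
      if w (Sum.inl ⟨i, x⟩) = 0 then y₀ (Sum.inl ⟨i, x⟩) q else 0, ?_, ?_, ?_, ?_, ?_, ?_⟩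
  · filter_upwards [(tendsto_root ρ).eventually hyC, self_mem_nhdsWithin] with t ht ht0
    obtain ⟨hzt, hzt0⟩ := hz t ht0
    obtain ⟨h1, h2⟩ := ht
    change (shiftMat k s R + z t ^ ρ.1 • pertMat D Xi Sg Xic Sgc) * Y t = Y t * (z t • C (z t)) at h1
    rw [hzt] at h1
    constructor
    · rw [← Matrix.mul_assoc, hAX, Matrix.mul_assoc, Matrix.add_mul, h1, Matrix.smul_mul,
        Matrix.one_mul, Matrix.mul_assoc X (Y t), Matrix.mul_add (Y t), Matrix.mul_smul (Y t) lam,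
        Matrix.mul_one]
    -- Undoing the basis change and the scaling, which is invertible for `t > 0`, reduces full rank
    -- to `P y = 1`.
    · refine rank_eq_of_leftInverse (L := P * (Matrix.diagonal (fun a => (z t ^ w a)⁻¹) *
        (Matrix.fromCols Sg Sgc).conjTranspose)) ?_
      have h3 : Matrix.diagonal (fun a => (z t ^ w a)⁻¹) * Matrix.diagonal (fun a => z t ^ w a) = 1 := by
        rw [Matrix.diagonal_mul_diagonal, ← Matrix.diagonal_one]
        congr 1
        funext a
        exact inv_mul_cancel₀ (pow_ne_zero _ hzt0)
      rw [Matrix.mul_assoc, Matrix.mul_assoc, ← Matrix.mul_assoc _ X, hinv', Matrix.one_mul,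
        ← Matrix.mul_assoc (Matrix.diagonal _), h3, Matrix.one_mul]
      exact h2
  · intro a q
    have h1 := isBigO_pow_mul ρ.1 1 (isBigO_comp_root ρ (hC a q))
    have h2 : ((1 : ℕ) : ℝ) / ρ.1 + 1 / ρ.1 = 2 / ρ.1 := by
      rw [Nat.cast_one]
      ring
    rw [h2] at h1
    refine h1.congr_left fun t => ?_
    simp only [Matrix.sub_apply, Matrix.add_apply, Matrix.smul_apply, smul_eq_mul, z, pow_one]
    ring
  · intro a q
    -- The remainder lies in the range of `Ξ_c`, whose rows have weight `ρ`, that is, order `t`.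
    have h1 : ∀ t, X * Y t - Xi * (Y t).submatrix Sum.inl id = Xic * (Y t).submatrix Sum.inr id := by
      intro t
      rw [hX, sub_eq_iff_eq_add', ← Matrix.fromCols_mul_fromRows]
      congr 1
      ext b q
      rcases b with b | b <;> rfl
    have h2 := fun t => leading_add_sum_blockCol Xi ρ (Y t) y₀
    simp only [Matrix.mul_assoc, ← hfirst]
    simp only [w, h2, h1, Matrix.mul_apply, Matrix.submatrix_apply, id]
    have h3 : ∀ b, (fun t => Xic a b * Y t (Sum.inr b) q) =O[𝓝[>] (0 : ℝ)]
        fun t : ℝ => t ^ (1 : ℝ) := fun b => by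
      have h4 := hYO (Sum.inr b) q
      simp only [w, weight, div_self hρ0] at h4
      exact h4.const_mul_left _
    exact Asymptotics.IsBigO.fun_sum fun b _ => h3 b
  · intro m x q
    have hw : w (Sum.inl ⟨ρ, (m, x)⟩) = m.1 := by simp [w, weight]
    have h1 := hYO' (Sum.inl ⟨ρ, (m, x)⟩) q
    rw [hw] at h1
    refine h1.congr_left fun t => ?_
    simp only [blockRow, Matrix.sub_apply, Matrix.of_apply, hYapp, hw]
    -- For `m = 0` the limit is already removed in `Hb`; for `m > 0` it is the explicit term `Q₁
    -- Ω^m`.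
    by_cases hm : (m : ℕ) = 0
    · simp [hm]
    · have h2 : y₀ (Sum.inl ⟨ρ, (m, x)⟩) q = (topBlock ρ Φ * Ω ^ (m : ℕ)) x q := by
        rw [← eq_topBlock_mul_pow hΦ m.1 m.2 x q, ← hy₀]
        rfl
      rw [if_neg hm, if_neg hm, smul_pow, Matrix.mul_smul, Matrix.smul_apply, h2, smul_eq_mul]
      ring
  · intro i hi m x q
    have hm := m.2
    have hw : w (Sum.inl ⟨i, (m, x)⟩) = ρ.1 - i.1 + m.1 := by simp [w, weight, hi.le]
    have h1 := hYO (Sum.inl ⟨i, (m, x)⟩) q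
    have h2 : ((ρ.1 - i.1 + m.1 : ℕ) : ℝ) / ρ.1 = 1 - ((i.1 : ℝ) - (m : ℝ)) / ρ.1 := by
      rw [Nat.cast_add, Nat.cast_sub hi.le]
      field_simp
      ring
    rw [hw, h2] at h1
    refine h1.congr_left fun t => ?_
    simp only [blockRow, Matrix.of_apply, hw]
    rw [if_neg (by omega), sub_zero]
  · intro i hi m x q
    have hρ := ρ.pos
    have hw : w (Sum.inl ⟨i, (m, x)⟩) = min m.1 ρ.1 := by simp [w, weight, not_le.2 hi]
    -- The first row has weight `0`, but its limit belongs to the leading term, so what is left is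
    -- `O(t^(1/ρ))`; hence the `max 1` in the exponent.
    by_cases hm : (m : ℕ) = 0
    · have h1 := hYO' (Sum.inl ⟨i, (m, x)⟩) q
      have h2 : min m.1 ρ.1 = 0 := by omega
      rw [hw, h2, Nat.cast_zero, zero_add] at h1
      rw [h2, max_eq_left zero_le_one, Nat.cast_one]
      refine h1.congr_left fun t => ?_
      simp [blockRow, hYapp, hw, h2]
    · have h1 := hYO (Sum.inl ⟨i, (m, x)⟩) q
      rw [hw] at h1
      rw [max_eq_right (by omega)]
      refine h1.congr_left fun t => ?_
      simp only [blockRow, Matrix.of_apply, hw]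
      rw [if_neg (by omega), sub_zero]
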